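/- **Virtual strings.** A virtual $n$-string $\beta$ consists of $n$ oriented (core) circles together with a finite set of arrows, an arrow being an ordered pair $(a,b)=(\text{tail},\text{head})$ of points of the circles, such that all endpoints of arrows are distinct. Two virtual $n$-strings are *equal as virtual $n$-strings* if an orientation-preserving homeomorphism between their unions of core circles (which may permute the circles) carries the set of arrows of one onto that of the other. The virtual 1-string induced on the $i$-th core circle of $\beta$ has as arrows the arrows of $\beta$ with both endpoints on that circle. **Virtual homotopy.** Two virtual $n$-strings are virtually homotopic, written $[\beta]=[\beta']$, if, up to equality as above, they are related by a finite sequence of the following moves and their inverses; here $xy$ denotes the arc running from $x$ to $y$ in the positive direction. * Type 1: given an arc $ab$ of a core circle containing no endpoints, add an arrow $(a,b)$ or an arrow $(b,a)$. * Type 2: let $\{a,a'\}$ and $\{b,b'\}$ be the pairs of ends (in either order) of two disjoint arcs of core circles containing no endpoints; add the arrows $(a,b)$ and $(b',a')$. * Type 3a: let $aa^+$, $bb^+$, $cc^+$ be disjoint arcs of core circles with no endpoints in their interiors. If $(a^+,b),(b^+,c),(c^+,a)$ are arrows, replace them with $(a,b^+),(b,c^+),(c,a^+)$. * Type 3b: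 for such arcs, if $(a,b),(a^+,c),(b^+,c^+)$ are arrows, replace them with $(a^+,b^+),(a,c^+),(b,c)$. A virtual string is nontrivial if it is not virtually homotopic to the one without arrows. **The family.** For integers $p_1,q_1,p_2,q_2,r,s\ge 0$ let $\beta(p_1,q_1,p_2,q_2,r,s)$ be the following virtual 2-string on two counterclockwise oriented circles. For $i=1,2$ the $i$-th circle carries $p_i$ parallel arrows from its left (angle $\pi$) to its right (angle $0$) and $q_i$ parallel arrows from its bottom (angle $3\pi/2$) to its top (angle $\pi/2$). In addition there are $r$ parallel arrows from angle $\pi/4$ on the first circle to angle $\pi/4$ on the second, and $s$ parallel arrows from angle $5\pi/4$ on the second circle to angle $5\pi/4$ on the first. Here a set of parallel arrows has its tails in a small arc around the first angle and its heads in a small arc around the second, the heads occurring in the reverse of the cyclic order of the tails; small arcs around different angles of a circle are disjoint. **Proposition.** Let $\beta_1=\beta(p_1,q_1,p_2,q_2,r,s)$ and $\beta_2=\beta(p_1',q_1',p_2',q_2',r',s')$ be two 2-strings of this family such that the virtual 1-strings induced on both core circles of $\beta_1$ and of $\beta_2$ are nontrivial. Then $[\beta_2]=[\beta_1]$ if and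 only if $\beta_2$ and $\beta_1$ are equal as virtual 2-strings. -/

import Mathlib

/-- Points of `n` disjoint copies of the oriented circle `ℝ / ℤ`: the index of the core circle and
the position on it. The circle is oriented by increasing parameter, and its cyclic order
(`btw`, `sbtw`) is the one of Mathlib. -/
abbrev CorePoint (n : ℕ) : Type := Fin n × UnitAddCircle

/-- A virtual `n`-string: `n` oriented circles with finitely many arrows, i.e. ordered pairs
`(tail, head)` of points, all of whose endpoints are distinct. -/
structure VirtualString (n : ℕ) where
  arrows : Set (CorePoint n × CorePoint n)
  finite_arrows : arrows.Finite
  tail_ne_head : ∀ g ∈ arrows, ∀ h ∈ arrows, g.1 ≠ h.2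
  tail_injOn : Set.InjOn Prod.fst arrows
  head_injOn : Set.InjOn Prod.snd arrows

namespace VirtualString

variable {n : ℕ}

/-- The set of all endpoints of arrows. -/
def endpoints (β : VirtualString n) : Set (CorePoint n) :=
  Prod.fst '' β.arrows ∪ Prod.snd '' β.arrows

/-- The virtual `n`-string without arrows. -/
def trivial (n : ℕ) : VirtualString n where
  arrows := ∅
  finite_arrows := Set.finite_empty
  tail_ne_head := by simp
  tail_injOn := by simp
  head_injOn := by simp

/-- The point of the single core circle of a 1-string, seen on the `i`-th of `n` core circles. -/
def onCircle (i : Fin n) (x : CorePoint 1) : CorePoint n := (i, x.2)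

theorem onCircle_injective (i : Fin n) : Function.Injective (onCircle i) := by
  rintro ⟨a, x⟩ ⟨b, y⟩ h
  have h2 : x = y := congrArg Prod.snd h
  exact Prod.ext (Subsingleton.elim _ _) h2

/-- The virtual 1-string induced on the `i`-th core circle: its arrows are the self-arrows of `β`
with both endpoints on that circle. -/
def component (β : VirtualString n) (i : Fin n) : VirtualString 1 where
  arrows := Prod.map (onCircle i) (onCircle i) ⁻¹' β.arrows
  finite_arrows := β.finite_arrows.preimage
    ((onCircle_injective i).prodMap (onCircle_injective i)).injOn
  tail_ne_head := fun _ hg _ hh e =>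
    β.tail_ne_head _ hg _ hh (congrArg (onCircle i) e)
  tail_injOn := fun _ hg _ hh e =>
    (onCircle_injective i).prodMap (onCircle_injective i)
      (β.tail_injOn hg hh (congrArg (onCircle i) e))
  head_injOn := fun _ hg _ hh e =>
    (onCircle_injective i).prodMap (onCircle_injective i)
      (β.head_injOn hg hh (congrArg (onCircle i) e))

/-- Equality as virtual `n`-strings: an orientation preserving homeomorphism of the union of the
core circles (which may permute them) carries the arrows of `β` to the arrows of `β'`. -/
def Same (β β' : VirtualString n) : Prop :=
  ∃ (σ : Equiv.Perm (Fin n)) (f : Fin n → (UnitAddCircle ≃ₜ UnitAddCircle)),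
    (∀ i x y z, sbtw (f i x) (f i y) (f i z) ↔ sbtw x y z) ∧
    β'.arrows =
      Prod.map (fun x : CorePoint n => (σ x.1, f x.1 x.2))
        (fun x : CorePoint n => (σ x.1, f x.1 x.2)) '' β.arrows

/-- The closed arc running from `a` to `b` in the positive direction (used for `a ≠ b` on the same
core circle). -/
def arc (a b : CorePoint n) : Set (CorePoint n) :=
  {x | x.1 = a.1 ∧ btw a.2 x.2 b.2}

/-- The interior of `arc a b`. -/
def openArc (a b : CorePoint n) : Set (CorePoint n) :=
  {x | x.1 = a.1 ∧ sbtw a.2 x.2 b.2}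

/-- The moves generating virtual homotopy. In every constructor the points involved are
automatically distinct, because all endpoints of a virtual string are. -/
inductive Move : VirtualString n → VirtualString n → Prop
  | type1a (β β' : VirtualString n) (a b : CorePoint n)
      (same : a.1 = b.1)
      (free : Disjoint (arc a b) β.endpoints)
      (add_arrow : β'.arrows = insert (a, b) β.arrows) : Move β β'
  | type1b (β β' : VirtualString n) (a b : CorePoint n)
      (same : a.1 = b.1)
      (free : Disjoint (arc a b) β.endpoints)
      (add_arrow : β'.arrows = insert (b, a) β.arrows) : Move β β'
  /-- The arcs run from `u` to `u'` and from `v` to `v'`; the two ends of each arc may be taken in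
  either order when the arrows are attached. -/
  | type2 (β β' : VirtualString n) (a a' b b' u u' v v' : CorePoint n)
      (endsA : (u, u') = (a, a') ∨ (u, u') = (a', a))
      (endsB : (v, v') = (b, b') ∨ (v, v') = (b', b))
      (sameA : u.1 = u'.1) (sameB : v.1 = v'.1)
      (freeA : Disjoint (arc u u') β.endpoints)
      (freeB : Disjoint (arc v v') β.endpoints)
      (disj : Disjoint (arc u u') (arc v v'))
      (add_arrows : β'.arrows = {(a, b), (b', a')} ∪ β.arrows) : Move β β'
  | type3a (β β' : VirtualString n) (a a' b b' c c' : CorePoint n)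
      (sameA : a.1 = a'.1) (sameB : b.1 = b'.1) (sameC : c.1 = c'.1)
      (freeA : Disjoint (openArc a a') β.endpoints)
      (freeB : Disjoint (openArc b b') β.endpoints)
      (freeC : Disjoint (openArc c c') β.endpoints)
      (disjAB : Disjoint (arc a a') (arc b b'))
      (disjBC : Disjoint (arc b b') (arc c c'))
      (disjCA : Disjoint (arc c c') (arc a a'))
      (old : {(a', b), (b', c), (c', a)} ⊆ β.arrows)
      (replace : β'.arrows =
        (β.arrows \ {(a', b), (b', c), (c', a)}) ∪ {(a, b'), (b, c'), (c, a')}) : Move β β'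
  | type3b (β β' : VirtualString n) (a a' b b' c c' : CorePoint n)
      (sameA : a.1 = a'.1) (sameB : b.1 = b'.1) (sameC : c.1 = c'.1)
      (freeA : Disjoint (openArc a a') β.endpoints)
      (freeB : Disjoint (openArc b b') β.endpoints)
      (freeC : Disjoint (openArc c c') β.endpoints)
      (disjAB : Disjoint (arc a a') (arc b b'))
      (disjBC : Disjoint (arc b b') (arc c c'))
      (disjCA : Disjoint (arc c c') (arc a a'))
      (old : {(a, b), (a', c), (b', c')} ⊆ β.arrows)
      (replace : β'.arrows =
        (β.arrows \ {(a, b), (a', c), (b', c')}) ∪ {(a', b'), (a, c'), (b, c)}) : Move β β'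

/-- Virtual homotopy of virtual `n`-strings (with unordered core circles): finite sequences of
moves and their inverses, virtual strings that are equal up to orientation preserving
homeomorphism being identified. -/
def VirtuallyHomotopic : VirtualString n → VirtualString n → Prop :=
  Relation.EqvGen fun β β' => Same β β' ∨ Move β β'

/-- A virtual string is nontrivial if it is not virtually homotopic to the one without arrows. -/
def IsNontrivial (β : VirtualString n) : Prop := ¬ VirtuallyHomotopic β (trivial n)

end VirtualString

/-- The `i`-th of `N` points, in positive cyclic order, placed in the open arc from `k / 8` to
`(k + 1) / 8` of the circle `ℝ / ℤ`. -/
noncomputable def clusterPoint (k : Fin 8) {N : ℕ} (i : Fin N) : UnitAddCircle :=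
  ((((k : ℕ) + ((i : ℕ) + 1) / (N + 1)) / 8 : ℝ) : UnitAddCircle)

theorem clusterPoint_eq {k k' : Fin 8} {N N' : ℕ} {i : Fin N} {i' : Fin N'}
    (h : clusterPoint k i = clusterPoint k' i') :
    k = k' ∧ (((i : ℕ) + 1 : ℝ) / (N + 1) = ((i' : ℕ) + 1) / (N' + 1)) := by
  have bd : ∀ {M : ℕ} (j : Fin M),
      0 < (((j : ℕ) + 1 : ℝ) / (M + 1)) ∧ (((j : ℕ) + 1 : ℝ) / (M + 1)) < 1 := by
    intro M j
    have hj : ((j : ℕ) : ℝ) < M := by exact_mod_cast j.2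
    refine ⟨by positivity, ?_⟩
    rw [div_lt_one (by positivity)]
    linarith
  obtain ⟨h0, h1⟩ := bd i
  obtain ⟨h0', h1'⟩ := bd i'
  have hk : ((k : ℕ) : ℝ) ≤ 7 := by exact_mod_cast Nat.lt_succ_iff.mp k.2
  have hk' : ((k' : ℕ) : ℝ) ≤ 7 := by exact_mod_cast Nat.lt_succ_iff.mp k'.2
  have p0 : (0 : ℝ) ≤ ((k : ℕ) : ℝ) := by positivity
  have p0' : (0 : ℝ) ≤ ((k' : ℕ) : ℝ) := by positivity
  unfold clusterPoint at h
  rw [AddCircle.coe_eq_coe_iff_of_mem_Ico (p := (1 : ℝ)) (a := 0)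
    (by constructor <;> linarith) (by constructor <;> linarith)] at h
  have e : k = k' := by
    apply Fin.ext
    have l1 : ((k : ℕ) : ℝ) < ((k' : ℕ) : ℝ) + 1 := by linarith
    have l2 : ((k' : ℕ) : ℝ) < ((k : ℕ) : ℝ) + 1 := by linarith
    have m1 : (k : ℕ) < (k' : ℕ) + 1 := by exact_mod_cast l1
    have m2 : (k' : ℕ) < (k : ℕ) + 1 := by exact_mod_cast l2
    omega
  subst e
  exact ⟨rfl, by linarith⟩

theorem clusterPoint_inj {k k' : Fin 8} {N : ℕ} {i i' : Fin N} :
    clusterPoint k i = clusterPoint k' i' ↔ k = k' ∧ i = i' := by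
  refine ⟨fun h => ?_, fun h => by rw [h.1, h.2]⟩
  obtain ⟨e, f⟩ := clusterPoint_eq h
  refine ⟨e, Fin.ext ?_⟩
  have hN : (0 : ℝ) < N + 1 := by positivity
  have f' := (div_left_inj' hN.ne').mp f
  have f2 : ((i : ℕ) : ℝ) = (i' : ℕ) := by linarith
  exact_mod_cast f2

theorem clusterPoint_ne {k k' : Fin 8} (hk : k ≠ k') {N N' : ℕ} (i : Fin N) (i' : Fin N') :
    clusterPoint k i ≠ clusterPoint k' i' := fun h => hk (clusterPoint_eq h).1

/-- The index type of the arrows of the 2-string `betaString p₁ q₁ p₂ q₂ r s`. -/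
abbrev BetaIndex (p₁ q₁ p₂ q₂ r s : ℕ) : Type :=
  (Fin p₁ ⊕ Fin q₁) ⊕ (Fin p₂ ⊕ Fin q₂) ⊕ (Fin r ⊕ Fin s)

section

variable {p₁ q₁ p₂ q₂ r s : ℕ}

/-- Tails of the arrows of `betaString`. In each circle, with angle `2 * π * t` at the point `t`,
there are `p` parallel arrows from the left (angle `π`) to the right (angle `0`) and `q` parallel
arrows from the bottom (angle `3 * π / 2`) to the top (angle `π / 2`); `r` parallel arrows run from
angle `π / 4` on the first circle to angle `π / 4` on the second, and `s` parallel arrows from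
angle `5 * π / 4` on the second circle to angle `5 * π / 4` on the first. Parallel arrows do not
cross, so that their heads occur in the reverse of the cyclic order of their tails. -/
noncomputable def betaTail : BetaIndex p₁ q₁ p₂ q₂ r s → CorePoint 2
  | .inl (.inl i) => (0, clusterPoint 4 i)
  | .inl (.inr i) => (0, clusterPoint 6 i)
  | .inr (.inl (.inl i)) => (1, clusterPoint 4 i)
  | .inr (.inl (.inr i)) => (1, clusterPoint 6 i)
  | .inr (.inr (.inl i)) => (0, clusterPoint 1 i)
  | .inr (.inr (.inr i)) => (1, clusterPoint 5 i)

/-- Heads of the arrows of `betaString`; see `betaTail`. -/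
noncomputable def betaHead : BetaIndex p₁ q₁ p₂ q₂ r s → CorePoint 2
  | .inl (.inl i) => (0, clusterPoint 0 i.rev)
  | .inl (.inr i) => (0, clusterPoint 2 i.rev)
  | .inr (.inl (.inl i)) => (1, clusterPoint 0 i.rev)
  | .inr (.inl (.inr i)) => (1, clusterPoint 2 i.rev)
  | .inr (.inr (.inl i)) => (1, clusterPoint 1 i.rev)
  | .inr (.inr (.inr i)) => (0, clusterPoint 5 i.rev)

theorem betaTail_injective :
    Function.Injective (betaTail : BetaIndex p₁ q₁ p₂ q₂ r s → CorePoint 2) := by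
  rintro ((i | i) | (i | i) | (i | i)) ((j | j) | (j | j) | (j | j)) h <;>
    simp [betaTail, clusterPoint_inj, clusterPoint_ne] at h ⊢ <;> exact h

theorem betaHead_injective :
    Function.Injective (betaHead : BetaIndex p₁ q₁ p₂ q₂ r s → CorePoint 2) := by
  rintro ((i | i) | (i | i) | (i | i)) ((j | j) | (j | j) | (j | j)) h <;>
    simp [betaHead, clusterPoint_inj, clusterPoint_ne] at h ⊢ <;> exact h

theorem betaTail_ne_betaHead (x y : BetaIndex p₁ q₁ p₂ q₂ r s) : betaTail x ≠ betaHead y := by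
  rcases x with ((i | i) | (i | i) | (i | i)) <;> rcases y with ((j | j) | (j | j) | (j | j)) <;>
    simp [betaTail, betaHead, clusterPoint_ne]

end

/-- The 2-string `β(p₁, q₁, p₂, q₂, r, s)`. -/
noncomputable def betaString (p₁ q₁ p₂ q₂ r s : ℕ) : VirtualString 2 where
  arrows := Set.range fun x : BetaIndex p₁ q₁ p₂ q₂ r s => (betaTail x, betaHead x)
  finite_arrows := Set.finite_range _
  tail_ne_head := by
    rintro _ ⟨x, rfl⟩ _ ⟨y, rfl⟩
    exact betaTail_ne_betaHead x y
  tail_injOn := by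
    rintro _ ⟨x, rfl⟩ _ ⟨y, rfl⟩ h
    rw [betaTail_injective h]
  head_injOn := by
    rintro _ ⟨x, rfl⟩ _ ⟨y, rfl⟩ h
    rw [betaHead_injective h]

/-!
On the surface carrying a virtual string, each self-crossing of the `i`-th core circle splits this
circle into two loops. Label a loop by its intersection numbers with the `i`-th core circle and with
the sum of all core circles. For a label whose first component is not `0`, the signed number of
loops with that label is a homotopy invariant: a move of type 1 creates loops with first component
`0`, the two crossings created by a move of type 2 have opposite signs, and a move of type 3 changes
neither the loops up to homology nor their intersection numbers. The same holds for the signed sum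
of the squares of the intersection numbers of pairs of loops with that label.

On a core circle of `β(p, q, …)`, only one loop at each crossing has a label with positive first
component. It is `(2q, 2q + 2v)` at the `p` horizontal arrows and `(2p, 2p + 2v)` at the `q`
vertical ones, with opposite signs, where `v` is the signed number of arrow ends at angle `5π/4`
(`-s` on the first circle and `s` on the second). Hence the number of loops determines `p`, `q` and
`v` if `p ≠ q`. If `p = q` these numbers cancel, but the sums of squares do not: only pairs of a
horizontal and a vertical loop intersect, and they all count with the same sign. For `p = q = 1` the
intersection number is `0`, and indeed the induced 1-string is then trivial. Finally, the
intersection number of the core circle with the sum of all core circles determines `r`.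
-/

section Circular

variable {α : Type*} [CircularOrder α]

theorem sbtw_congr_middle {x y a a' : α} (hx : sbtw a' x a) (hy : sbtw a' y a) :
    sbtw x a y ↔ sbtw x a' y :=
  ⟨fun h => (h.cyclic_right.trans_right hy.cyclic_left).cyclic_left,
    fun h => hx.cyclic_left.trans_right h⟩

theorem sbtw_congr_left {z b a a' : α} (hz : sbtw a' z a) (hb : sbtw a' b a) :
    sbtw a z b ↔ sbtw a' z b := by
  rw [sbtw_cyclic, sbtw_congr_middle hb hz, ← sbtw_cyclic]

theorem sbtw_or_sbtw_of_ne {a b c : α} (hab : a ≠ b) (hbc : b ≠ c) (hca : c ≠ a) :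
    sbtw a b c ∨ sbtw c b a := by
  by_contra! h
  rw [← btw_iff_not_sbtw, ← btw_iff_not_sbtw] at h
  rcases h.1.antisymm h.2 with e | e | e
  · exact hbc e.symm
  · exact hab e.symm
  · exact hca e.symm

theorem not_btw_of_sbtw_of_btw {w x y z u : α} (hx : sbtw w x y) (hy : sbtw w y z)
    (hu : btw w u x) : ¬btw y u z := by
  suffices h : sbtw z u y from h.not_btw
  by_cases huw : u = w
  · exact huw ▸ hy.cyclic_right
  by_cases hux : u = x
  · exact hux ▸ (hy.cyclic_left.trans_right hx.cyclic_right).cyclic_left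
  have hxw : x ≠ w := by rintro rfl; exact sbtw_irrefl_left hx
  rcases sbtw_or_sbtw_of_ne (Ne.symm huw) hux hxw with h | h
  · exact (hy.cyclic_left.trans_right (h.trans_right hx).cyclic_right).cyclic_left
  · exact absurd hu h.not_btw

end Circular

namespace VirtualString

variable {n : ℕ}

section Arcs

variable {a a' b x y z : CorePoint n}

theorem left_mem_arc (a b : CorePoint n) : a ∈ arc a b := ⟨rfl, btw_rfl_left⟩

theorem right_mem_arc (h : a.1 = b.1) : b ∈ arc a b := ⟨h.symm, btw_rfl_right⟩

theorem openArc_subset_arc (a b : CorePoint n) : openArc a b ⊆ arc a b := fun _ h => ⟨h.1, h.2.btw⟩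

theorem left_notMem_openArc (a b : CorePoint n) : a ∉ openArc a b :=
  fun h => sbtw_irrefl_left h.2

theorem right_notMem_openArc (a b : CorePoint n) : b ∉ openArc a b :=
  fun h => sbtw_irrefl_right h.2

theorem mem_openArc_or_mem_openArc (hab : a.1 = b.1) (hne : a ≠ b) (hz : z.1 = a.1) (ha : z ≠ a)
    (hb : z ≠ b) : z ∈ openArc a b ∨ z ∈ openArc b a :=
  (sbtw_or_sbtw_of_ne (fun e => ha (Prod.ext hz e.symm)) (fun e => hb (Prod.ext (hz.trans hab) e))
    (fun e => hne (Prod.ext hab e.symm))).imp (⟨hz, ·⟩) (⟨hz.trans hab, ·⟩)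

theorem mem_openArc_of_mem_arc (hab : a.1 = b.1) (hne : a ≠ b) (hz : z ∈ arc a b) (ha : z ≠ a)
    (hb : z ≠ b) : z ∈ openArc a b :=
  (mem_openArc_or_mem_openArc hab hne hz.1 ha hb).resolve_right fun h => h.2.not_btw hz.2

theorem sbtw_of_notMem_arc (hz : z.1 = a.1) (h : z ∉ arc a b) : sbtw b.2 z.2 a.2 := by
  rw [sbtw_iff_not_btw]
  exact fun h' => h ⟨hz, h'⟩

theorem ne_of_disjoint_arc {b' : CorePoint n} (hd : Disjoint (arc a a') (arc b b'))
    (hx : x ∈ arc a a') (hy : y ∈ arc b b') : x ≠ y :=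
  Set.disjoint_iff_forall_ne.1 hd hx hy

/-- The indicator function of the `i`-th core circle. -/
def circleIndicator (i : Fin n) (z : CorePoint n) : ℤ := if z.1 = i then 1 else 0

theorem circleIndicator_of_ne {i : Fin n} (h : z.1 ≠ i) : circleIndicator i z = 0 := if_neg h

open Classical in
/-- The indicator function of the arc from `a` to `b`, multiplied by `2` so that the ends of the
arc can be counted with half weight. -/
noncomputable def arcWeight (a b z : CorePoint n) : ℤ :=
  if z = a ∨ z = b then 1 else if z ∈ openArc a b then 2 else 0

@[simp] theorem arcWeight_left (a b : CorePoint n) : arcWeight a b a = 1 := by simp [arcWeight]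

@[simp] theorem arcWeight_right (a b : CorePoint n) : arcWeight a b b = 1 := by simp [arcWeight]

theorem arcWeight_of_mem (h : z ∈ openArc a b) : arcWeight a b z = 2 := by
  have ha : z ≠ a := by rintro rfl; exact left_notMem_openArc _ _ h
  have hb : z ≠ b := by rintro rfl; exact right_notMem_openArc _ _ h
  simp [arcWeight, ha, hb, h]

theorem arcWeight_of_notMem (ha : z ≠ a) (hb : z ≠ b) (h : z ∉ openArc a b) :
    arcWeight a b z = 0 := by
  simp [arcWeight, ha, hb, h]

theorem arcWeight_of_mem_swap (h : z ∈ openArc b a) : arcWeight a b z = 0 :=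
  arcWeight_of_notMem (by rintro rfl; exact right_notMem_openArc _ _ h)
    (by rintro rfl; exact left_notMem_openArc _ _ h) fun h' => h.2.not_sbtw h'.2

theorem arcWeight_eq_of_mem_openArc_iff {c d : CorePoint n} (ha : z ≠ a) (hb : z ≠ b)
    (hc : x ≠ c) (hd : x ≠ d) (h : z ∈ openArc a b ↔ x ∈ openArc c d) :
    arcWeight a b z = arcWeight c d x := by
  by_cases hz : z ∈ openArc a b
  · rw [arcWeight_of_mem hz, arcWeight_of_mem (h.1 hz)]
  · rw [arcWeight_of_notMem ha hb hz, arcWeight_of_notMem hc hd (mt h.2 hz)]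

theorem arcWeight_of_fst_ne (hab : a.1 = b.1) (h : z.1 ≠ a.1) : arcWeight a b z = 0 :=
  arcWeight_of_notMem (by rintro rfl; exact h rfl) (by rintro rfl; exact h hab.symm)
    (fun h' => h h'.1)

theorem notMem_arc_of_arcWeight_eq_zero (hab : a.1 = b.1) (hne : a ≠ b)
    (h : arcWeight a b z = 0) : z ∉ arc a b := by
  intro hz
  have ha : z ≠ a := by rintro rfl; simp at h
  have hb : z ≠ b := by rintro rfl; simp at h
  simp [arcWeight_of_mem (mem_openArc_of_mem_arc hab hne hz ha hb)] at h

theorem arcWeight_swap (hab : a.1 = b.1) (hne : a ≠ b) (z : CorePoint n) :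
    arcWeight b a z = 2 * circleIndicator a.1 z - arcWeight a b z := by
  by_cases hz : z.1 = a.1
  · have hi : circleIndicator a.1 z = 1 := if_pos hz
    by_cases ha : z = a
    · simp [ha, circleIndicator]
    by_cases hb : z = b
    · simp [hb, circleIndicator, hab]
    rcases mem_openArc_or_mem_openArc hab hne hz ha hb with h | h
    · rw [arcWeight_of_mem h, arcWeight_of_mem_swap h, hi]; rfl
    · rw [arcWeight_of_mem h, arcWeight_of_mem_swap h, hi]; rfl
  · rw [arcWeight_of_fst_ne hab hz, arcWeight_of_fst_ne hab.symm (hab ▸ hz)]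
    simp [circleIndicator, hz]

theorem arcWeight_congr_point (haa : a.1 = a'.1) (hxy : x.1 = y.1) (hx : x ∉ arc a a')
    (hy : y ∉ arc a a') : arcWeight x y a = arcWeight x y a' := by
  have ne {u v : CorePoint n} (hu : u ∈ arc a a') (hv : v ∉ arc a a') : u ≠ v :=
    fun e => hv (e ▸ hu)
  refine arcWeight_eq_of_mem_openArc_iff (ne (left_mem_arc _ _) hx) (ne (left_mem_arc _ _) hy)
    (ne (right_mem_arc haa) hx) (ne (right_mem_arc haa) hy) ?_
  by_cases hc : a.1 = x.1
  · have := sbtw_congr_middle (sbtw_of_notMem_arc hc.symm hx)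
      (sbtw_of_notMem_arc (hxy.symm.trans hc.symm) hy)
    simp [openArc, hc, ← haa, this]
  · simp [openArc, hc, ← haa]

theorem arcWeight_congr_left (haa : a.1 = a'.1) (hab : a.1 = b.1) (hb : b ∉ arc a a')
    (hz : z ∉ arc a a') : arcWeight a b z = arcWeight a' b z := by
  by_cases hzb : z = b
  · simp [hzb]
  refine arcWeight_eq_of_mem_openArc_iff (fun e => hz (e ▸ left_mem_arc _ _)) hzb
    (by rintro rfl; exact hz (right_mem_arc haa)) hzb ?_
  by_cases hc : z.1 = a.1
  · have := sbtw_congr_left (sbtw_of_notMem_arc hc hz) (sbtw_of_notMem_arc hab.symm hb)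
    simp [openArc, hc, ← haa, this]
  · simp [openArc, hc, ← haa]

theorem arcWeight_congr_right (haa : a.1 = a'.1) (hab : a.1 = b.1) (hb : b ∉ arc a a')
    (hz : z ∉ arc a a') : arcWeight b a z = arcWeight b a' z := by
  rw [arcWeight_swap hab (by rintro rfl; exact hb (left_mem_arc _ _)) z,
    arcWeight_swap (haa.symm.trans hab) (by rintro rfl; exact hb (right_mem_arc haa)) z,
    arcWeight_congr_left haa hab hb hz, haa]

theorem arcWeight_left_end (haa : a.1 = a'.1) (hab : a.1 = b.1) (hb : b ∉ arc a a') :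
    arcWeight a b a' = 2 :=
  arcWeight_of_mem ⟨haa.symm, (sbtw_of_notMem_arc hab.symm hb).cyclic_right⟩

theorem arcWeight_right_start (hab : a.1 = b.1) (hb : b ∉ arc a a') : arcWeight b a' a = 2 :=
  arcWeight_of_mem ⟨hab, (sbtw_of_notMem_arc hab.symm hb).cyclic_left⟩

theorem arcWeight_left_start (haa : a.1 = a'.1) (hab : a.1 = b.1) (hb : b ∉ arc a a') :
    arcWeight a' b a = 0 := by
  rw [arcWeight_swap (hab.symm.trans haa) (by rintro rfl; exact hb (right_mem_arc haa)),
    arcWeight_right_start hab hb]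
  simp [circleIndicator, hab]

theorem arcWeight_right_end (haa : a.1 = a'.1) (hab : a.1 = b.1) (hb : b ∉ arc a a') :
    arcWeight b a a' = 0 := by
  rw [arcWeight_swap hab (by rintro rfl; exact hb (left_mem_arc _ _)),
    arcWeight_left_end haa hab hb]
  simp [circleIndicator, haa]

end Arcs

section Adjacent

/-- Two points of a core circle are adjacent if one of the two arcs between them contains no
endpoint of an arrow in its interior. -/
def Adjacent (β : VirtualString n) (a a' : CorePoint n) : Prop :=
  a.1 = a'.1 ∧ (Disjoint (openArc a a') β.endpoints ∨ Disjoint (openArc a' a) β.endpoints)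

variable {β : VirtualString n} {a a' b x y z : CorePoint n}

theorem notMem_arc_of_disjoint (haa : a.1 = a'.1) (hne : a ≠ a')
    (h : Disjoint (openArc a a') β.endpoints) (hz : z ∈ β.endpoints) (hza : z ≠ a) (hza' : z ≠ a') :
    z ∉ arc a a' :=
  fun hz' => Set.disjoint_right.1 h hz (mem_openArc_of_mem_arc haa hne hz' hza hza')

theorem Adjacent.refl (β : VirtualString n) (a : CorePoint n) : Adjacent β a a :=
  ⟨rfl, .inl <| Set.disjoint_left.2 fun _ hz _ => sbtw_irrefl_left_right hz.2⟩

theorem Adjacent.arcWeight_congr_point (h : Adjacent β a a') (hxy : x.1 = y.1)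
    (hx : x ∈ β.endpoints) (hy : y ∈ β.endpoints) (hxa : x ≠ a) (hxa' : x ≠ a') (hya : y ≠ a)
    (hya' : y ≠ a') : arcWeight x y a = arcWeight x y a' := by
  obtain rfl | hne := eq_or_ne a a'
  · rfl
  obtain ⟨haa, free | free⟩ := h
  · have off {z} := notMem_arc_of_disjoint (z := z) haa hne free
    exact VirtualString.arcWeight_congr_point haa hxy (off hx hxa hxa') (off hy hya hya')
  · have off {z} := notMem_arc_of_disjoint (z := z) haa.symm hne.symm free
    exact (VirtualString.arcWeight_congr_point haa.symm hxy (off hx hxa' hxa)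
      (off hy hya' hya)).symm

theorem Adjacent.arcWeight_congr_left (h : Adjacent β a a') (hab : a.1 = b.1)
    (hb : b ∈ β.endpoints) (hz : z ∈ β.endpoints) (hba : b ≠ a) (hba' : b ≠ a') (hza : z ≠ a)
    (hza' : z ≠ a') : arcWeight a b z = arcWeight a' b z := by
  obtain rfl | hne := eq_or_ne a a'
  · rfl
  obtain ⟨haa, free | free⟩ := h
  · have off {z} := notMem_arc_of_disjoint (z := z) haa hne free
    exact VirtualString.arcWeight_congr_left haa hab (off hb hba hba') (off hz hza hza')
  · have off {z} := notMem_arc_of_disjoint (z := z) haa.symm hne.symm free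
    exact (VirtualString.arcWeight_congr_left haa.symm (haa ▸ hab) (off hb hba' hba)
      (off hz hza' hza)).symm

theorem Adjacent.arcWeight_congr_right (h : Adjacent β a a') (hab : a.1 = b.1)
    (hb : b ∈ β.endpoints) (hz : z ∈ β.endpoints) (hba : b ≠ a) (hba' : b ≠ a') (hza : z ≠ a)
    (hza' : z ≠ a') : arcWeight b a z = arcWeight b a' z := by
  rw [arcWeight_swap hab hba.symm z, arcWeight_swap (h.1.symm.trans hab) hba'.symm z,
    h.arcWeight_congr_left hab hb hz hba hba' hza hza', h.1]

theorem Adjacent.arcWeight_left_add (h : Adjacent β a a') (hab : a.1 = b.1)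
    (hb : b ∈ β.endpoints) (hba : b ≠ a) (hba' : b ≠ a') :
    arcWeight a b a' + arcWeight a' b a = 2 := by
  obtain rfl | hne := eq_or_ne a a'
  · simp
  obtain ⟨haa, free | free⟩ := h
  · have off := notMem_arc_of_disjoint haa hne free hb hba hba'
    rw [arcWeight_left_end haa hab off, arcWeight_left_start haa hab off, add_zero]
  · have off := notMem_arc_of_disjoint haa.symm hne.symm free hb hba' hba
    rw [arcWeight_left_end haa.symm (haa ▸ hab) off,
      arcWeight_left_start haa.symm (haa ▸ hab) off, zero_add]

theorem Adjacent.arcWeight_right_add (h : Adjacent β a a') (hab : a.1 = b.1)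
    (hb : b ∈ β.endpoints) (hba : b ≠ a) (hba' : b ≠ a') :
    arcWeight b a a' + arcWeight b a' a = 2 := by
  have sum := h.arcWeight_left_add hab hb hba hba'
  rw [arcWeight_swap hab hba.symm, arcWeight_swap (h.1.symm.trans hab) hba'.symm]
  simp only [circleIndicator, h.1, if_true]
  linarith

end Adjacent

section Pairing

/-- The contribution of the arrow `g` to the intersection pairing: the antisymmetrized product of
the values at the tail and at the head. -/
def arrowPairing (g : CorePoint n × CorePoint n) : LinearMap.BilinForm ℤ (CorePoint n → ℤ) :=
  LinearMap.BilinForm.linMulLin (LinearMap.proj g.1) (LinearMap.proj g.2) -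
    LinearMap.BilinForm.linMulLin (LinearMap.proj g.2) (LinearMap.proj g.1)

/-- The intersection pairing of `β`. For indicator functions of unions of arcs it is the
intersection number of the corresponding cycles on the surface carrying `β`; only the values at
endpoints of arrows matter. -/
noncomputable def pairing (β : VirtualString n) : LinearMap.BilinForm ℤ (CorePoint n → ℤ) :=
  ∑ g ∈ β.finite_arrows.toFinset, arrowPairing g

variable {β β' : VirtualString n} {g : CorePoint n × CorePoint n} {φ φ' ψ ψ' : CorePoint n → ℤ}

theorem arrowPairing_apply (g : CorePoint n × CorePoint n) (φ ψ : CorePoint n → ℤ) :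
    arrowPairing g φ ψ = φ g.1 * ψ g.2 - φ g.2 * ψ g.1 := rfl

theorem pairing_apply (β : VirtualString n) (φ ψ : CorePoint n → ℤ) :
    pairing β φ ψ = ∑ g ∈ β.finite_arrows.toFinset, (φ g.1 * ψ g.2 - φ g.2 * ψ g.1) := by
  simp only [pairing, LinearMap.sum_apply, arrowPairing_apply]

@[simp] theorem pairing_self (β : VirtualString n) (φ : CorePoint n → ℤ) :
    pairing β φ φ = 0 := by
  rw [pairing_apply]
  exact Finset.sum_eq_zero fun g _ => by ring

theorem neg_pairing (β : VirtualString n) (φ ψ : CorePoint n → ℤ) :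
    -pairing β φ ψ = pairing β ψ φ :=
  LinearMap.IsAlt.neg (fun φ => pairing_self β φ) φ ψ

theorem tail_mem_endpoints (h : g ∈ β.arrows) : g.1 ∈ β.endpoints := Or.inl ⟨g, h, rfl⟩

theorem head_mem_endpoints (h : g ∈ β.arrows) : g.2 ∈ β.endpoints := Or.inr ⟨g, h, rfl⟩

theorem ne_of_mem_arrows (h : g ∈ β.arrows) : g.1 ≠ g.2 := β.tail_ne_head g h g h

theorem pairing_congr (hφ : Set.EqOn φ φ' β.endpoints) (hψ : Set.EqOn ψ ψ' β.endpoints) :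
    pairing β φ ψ = pairing β φ' ψ' := by
  rw [pairing_apply, pairing_apply]
  refine Finset.sum_congr rfl fun g hg => ?_
  have hg : g ∈ β.arrows := β.finite_arrows.mem_toFinset.1 hg
  rw [hφ (tail_mem_endpoints hg), hφ (head_mem_endpoints hg), hψ (tail_mem_endpoints hg),
    hψ (head_mem_endpoints hg)]

theorem pairing_single_tail (he : e ∈ β.arrows) (ψ : CorePoint n → ℤ) :
    pairing β (Pi.single e.1 1) ψ = ψ e.2 := by
  rw [pairing_apply, Finset.sum_eq_single e]
  · simp [(ne_of_mem_arrows he).symm]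
  · intro g hg hge
    have hg : g ∈ β.arrows := β.finite_arrows.mem_toFinset.1 hg
    have htail : g.1 ≠ e.1 := fun h => hge (β.tail_injOn hg he h)
    have hhead : g.2 ≠ e.1 := (β.tail_ne_head e he g hg).symm
    simp [htail, hhead]
  · simp [he]

theorem pairing_single_head (he : e ∈ β.arrows) (ψ : CorePoint n → ℤ) :
    pairing β (Pi.single e.2 1) ψ = -ψ e.1 := by
  rw [pairing_apply, Finset.sum_eq_single e]
  · simp [ne_of_mem_arrows he]
  · intro g hg hge
    have hg : g ∈ β.arrows := β.finite_arrows.mem_toFinset.1 hg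
    have htail : g.1 ≠ e.2 := β.tail_ne_head g hg e he
    have hhead : g.2 ≠ e.2 := fun h => hge (β.head_injOn hg he h)
    simp [htail, hhead]
  · simp [he]

theorem pairing_image {Φ : CorePoint n → CorePoint n} (hΦ : Function.Injective Φ)
    (h : β'.arrows = Prod.map Φ Φ '' β.arrows) (φ ψ : CorePoint n → ℤ) :
    pairing β' φ ψ = pairing β (φ ∘ Φ) (ψ ∘ Φ) := by
  classical
  have arrows_eq :
      β'.finite_arrows.toFinset = β.finite_arrows.toFinset.image (Prod.map Φ Φ) := by
    ext g; simp [h]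
  rw [pairing_apply, arrows_eq, Finset.sum_image (hΦ.prodMap hΦ).injOn, pairing_apply]
  rfl

theorem pairing_union {T : Finset (CorePoint n × CorePoint n)} (hT : ∀ g ∈ T, g ∉ β.arrows)
    (h : β'.arrows = ↑T ∪ β.arrows) (φ ψ : CorePoint n → ℤ) :
    pairing β' φ ψ = ∑ g ∈ T, (φ g.1 * ψ g.2 - φ g.2 * ψ g.1) + pairing β φ ψ := by
  classical
  have arrows_eq : β'.finite_arrows.toFinset = T ∪ β.finite_arrows.toFinset := by
    ext g; simp [h]
  rw [pairing_apply, arrows_eq, Finset.sum_union, pairing_apply]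
  exact Finset.disjoint_left.2 fun g hg hg' => hT g hg (by simpa using hg')

end Pairing

section Invariants

/-- The arrows of `β` with both endpoints on the `i`-th core circle. -/
noncomputable def selfArrows (β : VirtualString n) (i : Fin n) :
    Finset (CorePoint n × CorePoint n) :=
  β.finite_arrows.toFinset.filter fun g => g.1.1 = i ∧ g.2.1 = i

/-- The class of the loop that runs along the core circle from the tail of the self-arrow `g` to
its head; the other loop based at the crossing `g` is the one of `g.swap`. -/
noncomputable def loopClass (g : CorePoint n × CorePoint n) : CorePoint n → ℤ :=
  arcWeight g.1 g.2

/-- The signed sum of the values of `f` on the two loops based at each self-crossing of the `i`-th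
core circle. -/
noncomputable def loopSum (β : VirtualString n) (i : Fin n) (f : (CorePoint n → ℤ) → ℤ) : ℤ :=
  ∑ g ∈ selfArrows β i, (f (loopClass g) - f (loopClass g.swap))

/-- The intersection numbers of a cycle with the `i`-th core circle and with the sum of all core
circles. -/
noncomputable def loopLabel (β : VirtualString n) (i : Fin n) (φ : CorePoint n → ℤ) : ℤ × ℤ :=
  (pairing β φ (circleIndicator i), pairing β φ 1)

/-- The intersection number of the `i`-th core circle with the sum of all core circles. -/
noncomputable def circleIndex (β : VirtualString n) (i : Fin n) : ℤ :=
  pairing β (circleIndicator i) 1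

/-- The signed number of loops with label `κ` on the `i`-th core circle. -/
noncomputable def linearInvariant (β : VirtualString n) (i : Fin n) (κ : ℤ × ℤ) : ℤ :=
  loopSum β i fun φ => if loopLabel β i φ = κ then 1 else 0

/-- The square of the intersection number of `φ` and `ψ` if both have label `κ`, else `0`. -/
noncomputable def labelledSquare (β : VirtualString n) (i : Fin n) (κ : ℤ × ℤ)
    (φ ψ : CorePoint n → ℤ) : ℤ :=
  if loopLabel β i φ = κ ∧ loopLabel β i ψ = κ then pairing β φ ψ ^ 2 else 0

/-- The signed sum of the squares of the intersection numbers of the pairs of loops with label `κ`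
on the `i`-th core circle. -/
noncomputable def quadraticInvariant (β : VirtualString n) (i : Fin n) (κ : ℤ × ℤ) : ℤ :=
  loopSum β i fun φ => loopSum β i (labelledSquare β i κ φ)

/-- The homotopy invariants of the `i`-th core circle of `β` agree with those of the `j`-th core
circle of `β'`. Labels with first component `0` are excluded, because a move of type 1 creates a
loop with such a label. -/
structure SameInvariants (β : VirtualString n) (i : Fin n) (β' : VirtualString n) (j : Fin n) :
    Prop where
  circleIndex_eq : circleIndex β i = circleIndex β' j
  linearInvariant_eq : ∀ κ : ℤ × ℤ, κ.1 ≠ 0 → linearInvariant β i κ = linearInvariant β' j κ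
  quadraticInvariant_eq :
    ∀ κ : ℤ × ℤ, κ.1 ≠ 0 → quadraticInvariant β i κ = quadraticInvariant β' j κ

theorem SameInvariants.refl (β : VirtualString n) (i : Fin n) : SameInvariants β i β i :=
  ⟨rfl, fun _ _ => rfl, fun _ _ => rfl⟩

variable {β β' β'' : VirtualString n} {i j k : Fin n} {g h : CorePoint n × CorePoint n}
  {φ φ' ψ : CorePoint n → ℤ}

theorem SameInvariants.symm (h : SameInvariants β i β' j) : SameInvariants β' j β i :=
  ⟨h.1.symm, fun κ hκ => (h.2 κ hκ).symm, fun κ hκ => (h.3 κ hκ).symm⟩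

theorem SameInvariants.trans (h : SameInvariants β i β' j) (h' : SameInvariants β' j β'' k) :
    SameInvariants β i β'' k :=
  ⟨h.1.trans h'.1, fun κ hκ => (h.2 κ hκ).trans (h'.2 κ hκ),
    fun κ hκ => (h.3 κ hκ).trans (h'.3 κ hκ)⟩

theorem mem_selfArrows : g ∈ selfArrows β i ↔ g ∈ β.arrows ∧ g.1.1 = i ∧ g.2.1 = i := by
  simp [selfArrows]

theorem loopClass_swap (hg : g ∈ selfArrows β i) :
    loopClass g.swap = (2 : ℤ) • circleIndicator i - loopClass g := by
  obtain ⟨harrow, htail, hhead⟩ := mem_selfArrows.1 hg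
  funext z
  exact htail ▸ arcWeight_swap (htail.trans hhead.symm) (ne_of_mem_arrows harrow) z

theorem loopLabel_swap (hg : g ∈ selfArrows β i) :
    loopLabel β i (loopClass g.swap) = (0, 2 * circleIndex β i) - loopLabel β i (loopClass g) := by
  rw [loopClass_swap hg]
  simp only [loopLabel, circleIndex, map_sub, map_smul, LinearMap.sub_apply, LinearMap.smul_apply,
    pairing_self, smul_eq_mul, mul_zero, Prod.mk_sub_mk]

/-- The intersection numbers of `φ` and `φ'` that enter the invariants of the `i`-th core circle
agree. -/
structure SamePairings (β : VirtualString n) (i : Fin n) (φ φ' : CorePoint n → ℤ) : Prop where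
  circle : pairing β φ (circleIndicator i) = pairing β φ' (circleIndicator i)
  one : pairing β φ 1 = pairing β φ' 1
  loop : ∀ g ∈ selfArrows β i, pairing β φ (loopClass g) = pairing β φ' (loopClass g)

/-- A function of cycles that, like those summed in the invariants, only depends on intersection
numbers and vanishes on the cycles whose intersection number with the `i`-th core circle is `0`. -/
structure IsLoopFunction (β : VirtualString n) (i : Fin n) (f : (CorePoint n → ℤ) → ℤ) : Prop where
  congr : ∀ φ φ', SamePairings β i φ φ' → f φ = f φ'
  eq_zero : ∀ φ, pairing β φ (circleIndicator i) = 0 → f φ = 0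

theorem SamePairings.loopLabel_eq (h : SamePairings β i φ φ') :
    loopLabel β i φ = loopLabel β i φ' :=
  Prod.ext h.circle h.one

theorem SamePairings.loop_swap (h : SamePairings β i φ φ') (hg : g ∈ selfArrows β i) :
    pairing β φ (loopClass g.swap) = pairing β φ' (loopClass g.swap) := by
  simp only [loopClass_swap hg, map_sub, map_smul, h.circle, h.loop g hg]

theorem SamePairings.complement (h : SamePairings β i φ φ') :
    SamePairings β i ((2 : ℤ) • circleIndicator i - φ) ((2 : ℤ) • circleIndicator i - φ') where
  circle := by simp only [map_sub, LinearMap.sub_apply, h.circle]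
  one := by simp only [map_sub, LinearMap.sub_apply, h.one]
  loop g hg := by simp only [map_sub, LinearMap.sub_apply, h.loop g hg]

theorem isLoopFunction_label {κ : ℤ × ℤ} (hκ : κ.1 ≠ 0) :
    IsLoopFunction β i fun φ => if loopLabel β i φ = κ then 1 else 0 where
  congr φ φ' h := by simp only [h.loopLabel_eq]
  eq_zero φ h := if_neg fun e => hκ ((congrArg Prod.fst e).symm.trans h)

theorem labelledSquare_congr_left {κ : ℤ × ℤ} (hlabel : loopLabel β i φ = loopLabel β i φ')
    (hpair : pairing β φ ψ = pairing β φ' ψ) :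
    labelledSquare β i κ φ ψ = labelledSquare β i κ φ' ψ := by
  rw [labelledSquare, labelledSquare, hlabel, hpair]

theorem labelledSquare_comm (κ : ℤ × ℤ) :
    labelledSquare β i κ φ ψ = labelledSquare β i κ ψ φ := by
  simp only [labelledSquare, and_comm, ← neg_pairing β φ ψ, neg_sq]

theorem labelledSquare_eq_zero {κ : ℤ × ℤ} (hκ : κ.1 ≠ 0)
    (h : pairing β φ (circleIndicator i) = 0) : labelledSquare β i κ φ ψ = 0 :=
  if_neg fun e => hκ ((congrArg Prod.fst e.1).symm.trans h)

theorem isLoopFunction_loopSum_labelledSquare {κ : ℤ × ℤ} (hκ : κ.1 ≠ 0) :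
    IsLoopFunction β i fun φ => loopSum β i (labelledSquare β i κ φ) where
  congr φ φ' h := Finset.sum_congr rfl fun g hg => by
    rw [labelledSquare_congr_left h.loopLabel_eq (h.loop g hg),
      labelledSquare_congr_left h.loopLabel_eq (h.loop_swap hg)]
  eq_zero φ h := Finset.sum_eq_zero fun g _ => by
    rw [labelledSquare_eq_zero hκ h, labelledSquare_eq_zero hκ h, sub_zero]

theorem isLoopFunction_labelledSquare {κ : ℤ × ℤ} (hκ : κ.1 ≠ 0)
    (hg : g ∈ selfArrows β i) (hψ : ψ = loopClass g ∨ ψ = loopClass g.swap) :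
    IsLoopFunction β i (labelledSquare β i κ ψ) where
  congr φ φ' h := by
    rw [labelledSquare_comm, labelledSquare_comm (φ := ψ)]
    refine labelledSquare_congr_left h.loopLabel_eq ?_
    rcases hψ with rfl | rfl
    exacts [h.loop g hg, h.loop_swap hg]
  eq_zero φ h := by rw [labelledSquare_comm, labelledSquare_eq_zero hκ h]

/-- A map of points that carries the self-arrows of the `i`-th core circle of `β` to self-arrows
of the `j`-th core circle of `β'` and preserves their intersection numbers. -/
structure PreservesLoops (β : VirtualString n) (i : Fin n) (β' : VirtualString n) (j : Fin n)
    (Φ : CorePoint n → CorePoint n) : Prop where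
  mem : ∀ g ∈ selfArrows β i, Prod.map Φ Φ g ∈ selfArrows β' j
  circleIndex_eq : circleIndex β' j = circleIndex β i
  circle : ∀ g ∈ selfArrows β i, pairing β' (loopClass (Prod.map Φ Φ g)) (circleIndicator j) =
    pairing β (loopClass g) (circleIndicator i)
  one : ∀ g ∈ selfArrows β i,
    pairing β' (loopClass (Prod.map Φ Φ g)) 1 = pairing β (loopClass g) 1
  loop : ∀ g ∈ selfArrows β i, ∀ h ∈ selfArrows β i,
    pairing β' (loopClass (Prod.map Φ Φ g)) (loopClass (Prod.map Φ Φ h)) =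
      pairing β (loopClass g) (loopClass h)

namespace PreservesLoops

variable {Φ : CorePoint n → CorePoint n}

theorem loopLabel_eq (H : PreservesLoops β i β' j Φ) (hg : g ∈ selfArrows β i) :
    loopLabel β' j (loopClass (Prod.map Φ Φ g)) = loopLabel β i (loopClass g) :=
  Prod.ext (H.circle g hg) (H.one g hg)

theorem loopLabel_swap_eq (H : PreservesLoops β i β' j Φ) (hg : g ∈ selfArrows β i) :
    loopLabel β' j (loopClass (Prod.map Φ Φ g).swap) = loopLabel β i (loopClass g.swap) := by
  rw [loopLabel_swap hg, loopLabel_swap (H.mem g hg), H.loopLabel_eq hg, H.circleIndex_eq]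

theorem loop_swap_right (H : PreservesLoops β i β' j Φ) (hg : g ∈ selfArrows β i)
    (hh : h ∈ selfArrows β i) :
    pairing β' (loopClass (Prod.map Φ Φ g)) (loopClass (Prod.map Φ Φ h).swap) =
      pairing β (loopClass g) (loopClass h.swap) := by
  simp only [loopClass_swap hh, loopClass_swap (H.mem h hh), map_sub, map_smul, H.circle g hg,
    H.loop g hg h hh]

theorem loop_swap_left (H : PreservesLoops β i β' j Φ) (hg : g ∈ selfArrows β i)
    (hh : h ∈ selfArrows β i) :
    pairing β' (loopClass (Prod.map Φ Φ g).swap) (loopClass (Prod.map Φ Φ h)) =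
      pairing β (loopClass g.swap) (loopClass h) := by
  rw [← neg_pairing, H.loop_swap_right hh hg, neg_pairing]

theorem loop_swap_swap (H : PreservesLoops β i β' j Φ) (hg : g ∈ selfArrows β i)
    (hh : h ∈ selfArrows β i) :
    pairing β' (loopClass (Prod.map Φ Φ g).swap) (loopClass (Prod.map Φ Φ h).swap) =
      pairing β (loopClass g.swap) (loopClass h.swap) := by
  rw [loopClass_swap hh, loopClass_swap (H.mem h hh), map_sub, map_sub, H.loop_swap_left hg hh,
    loopClass_swap hg, loopClass_swap (H.mem g hg)]
  simp only [map_smul, map_sub, LinearMap.sub_apply, LinearMap.smul_apply, pairing_self,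
    H.circle g hg]

theorem sameInvariants (H : PreservesLoops β i β' j Φ)
    (hsum : ∀ f, IsLoopFunction β' j f → loopSum β' j f =
      ∑ g ∈ selfArrows β i,
        (f (loopClass (Prod.map Φ Φ g)) - f (loopClass (Prod.map Φ Φ g).swap))) :
    SameInvariants β i β' j where
  circleIndex_eq := H.circleIndex_eq.symm
  linearInvariant_eq κ hκ := by
    rw [linearInvariant, linearInvariant, hsum _ (isLoopFunction_label hκ)]
    exact Finset.sum_congr rfl fun g hg => by
      rw [H.loopLabel_eq hg, H.loopLabel_swap_eq hg]
  quadraticInvariant_eq κ hκ := by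
    rw [quadraticInvariant, quadraticInvariant,
      hsum _ (isLoopFunction_loopSum_labelledSquare hκ)]
    refine Finset.sum_congr rfl fun g hg => ?_
    rw [hsum _ (isLoopFunction_labelledSquare hκ (H.mem g hg) (.inl rfl)),
      hsum _ (isLoopFunction_labelledSquare hκ (H.mem g hg) (.inr rfl))]
    congr 1 <;> refine Finset.sum_congr rfl fun h hh => ?_ <;>
      simp only [labelledSquare, H.loopLabel_eq hg, H.loopLabel_eq hh, H.loopLabel_swap_eq hg,
        H.loopLabel_swap_eq hh, H.loop g hg h hh, H.loop_swap_right hg hh,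
        H.loop_swap_left hg hh, H.loop_swap_swap hg hh]

end PreservesLoops

end Invariants

section Image

variable {β β' : VirtualString n} {i j : Fin n} {Φ : CorePoint n → CorePoint n}

theorem map_mem_selfArrows (hij : ∀ z, (Φ z).1 = j ↔ z.1 = i)
    (h : β'.arrows = Prod.map Φ Φ '' β.arrows) {g : CorePoint n × CorePoint n}
    (hg : g ∈ selfArrows β i) : Prod.map Φ Φ g ∈ selfArrows β' j := by
  obtain ⟨harrow, htail, hhead⟩ := mem_selfArrows.1 hg
  exact mem_selfArrows.2 ⟨h ▸ ⟨g, harrow, rfl⟩, (hij _).2 htail, (hij _).2 hhead⟩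

theorem PreservesLoops.sameInvariants_of_image (H : PreservesLoops β i β' j Φ)
    (hΦ : Function.Injective Φ) (hij : ∀ z, (Φ z).1 = j ↔ z.1 = i)
    (h : β'.arrows = Prod.map Φ Φ '' β.arrows) : SameInvariants β i β' j := by
  refine H.sameInvariants fun f _ => Eq.symm <|
    Finset.sum_nbij (Prod.map Φ Φ) H.mem (hΦ.prodMap hΦ).injOn ?_ fun _ _ => rfl
  intro g hg
  obtain ⟨harrow, htail, hhead⟩ := mem_selfArrows.1 hg
  obtain ⟨e, he, rfl⟩ := h ▸ harrow
  exact ⟨e, mem_selfArrows.2 ⟨he, (hij _).1 htail, (hij _).1 hhead⟩, rfl⟩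

theorem Same.sameInvariants (h : Same β β') :
    ∃ σ : Equiv.Perm (Fin n), ∀ i, SameInvariants β i β' (σ i) := by
  obtain ⟨σ, f, hf, hA⟩ := h
  refine ⟨σ, fun i => ?_⟩
  set Φ : CorePoint n → CorePoint n := fun x => (σ x.1, f x.1 x.2)
  have hΦ : Function.Injective Φ := by
    rintro ⟨i, x⟩ ⟨j, y⟩ e
    obtain ⟨e1, e2⟩ := Prod.ext_iff.1 e
    obtain rfl : i = j := σ.injective e1
    exact Prod.ext rfl ((f i).injective e2)
  have circle : circleIndicator (σ i) ∘ Φ = circleIndicator i := by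
    funext z; simp [circleIndicator, Φ]
  have one : (1 : CorePoint n → ℤ) ∘ Φ = 1 := rfl
  have loop : ∀ g ∈ selfArrows β i, loopClass (Prod.map Φ Φ g) ∘ Φ = loopClass g := by
    intro g hg
    obtain ⟨-, htail, hhead⟩ := mem_selfArrows.1 hg
    funext z
    have : Φ z ∈ openArc (Φ g.1) (Φ g.2) ↔ z ∈ openArc g.1 g.2 := by
      simp only [openArc, Set.mem_ofPred_eq, Φ, σ.injective.eq_iff]
      refine and_congr_right fun hz => ?_
      rw [hz, hhead, htail, hf]
    simp only [Function.comp, loopClass, arcWeight, Prod.map_fst, Prod.map_snd, hΦ.eq_iff]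
    classical exact if_congr Iff.rfl rfl (if_congr this rfl rfl)
  have hij : ∀ z, (Φ z).1 = σ i ↔ z.1 = i := fun z => σ.injective.eq_iff
  have H : PreservesLoops β i β' (σ i) Φ :=
    { mem := fun g hg => map_mem_selfArrows hij hA hg
      circleIndex_eq := by rw [circleIndex, pairing_image hΦ hA, circle, one, circleIndex]
      circle := fun g hg => by rw [pairing_image hΦ hA, circle, loop g hg]
      one := fun g hg => by rw [pairing_image hΦ hA, one, loop g hg]
      loop := fun g hg h hh => by rw [pairing_image hΦ hA, loop g hg, loop h hh] }
  exact H.sameInvariants_of_image hΦ hij hA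

end Image

section AddedArrows

variable {β β' : VirtualString n} {i : Fin n} {a a' b : CorePoint n}
  {g h : CorePoint n × CorePoint n} {T : Finset (CorePoint n × CorePoint n)}

theorem SameInvariants.of_union (hT : ∀ g ∈ T, g ∉ β.arrows) (hA : β'.arrows = ↑T ∪ β.arrows)
    {P : Set (CorePoint n → ℤ)} (h_one : 1 ∈ P) (h_circle : circleIndicator i ∈ P)
    (h_loop : ∀ g ∈ selfArrows β i, loopClass g ∈ P)
    (h_pairing : ∀ φ ∈ P, ∀ ψ ∈ P, ∑ g ∈ T, (φ g.1 * ψ g.2 - φ g.2 * ψ g.1) = 0)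
    (h_sum : ∀ f, IsLoopFunction β' i f →
      ∑ g ∈ T with g.1.1 = i ∧ g.2.1 = i, (f (loopClass g) - f (loopClass g.swap)) = 0) :
    SameInvariants β i β' i := by
  classical
  have pairing_eq {φ ψ} (hφ : φ ∈ P) (hψ : ψ ∈ P) : pairing β' φ ψ = pairing β φ ψ := by
    rw [pairing_union hT hA, h_pairing φ hφ ψ hψ, zero_add]
  have selfArrows_eq :
      selfArrows β' i = (T.filter fun g => g.1.1 = i ∧ g.2.1 = i) ∪ selfArrows β i := by
    ext g
    simp only [mem_selfArrows, hA, Finset.mem_union, Finset.mem_filter, Set.mem_union,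
      Finset.mem_coe, or_and_right]
  have disjoint : Disjoint (T.filter fun g => g.1.1 = i ∧ g.2.1 = i) (selfArrows β i) :=
    Finset.disjoint_left.2 fun g hg hg' =>
      hT g (Finset.mem_of_mem_filter g hg) (mem_selfArrows.1 hg').1
  have H : PreservesLoops β i β' i id :=
    { mem := fun g hg => selfArrows_eq ▸ Finset.mem_union_right _ hg
      circleIndex_eq := pairing_eq h_circle h_one
      circle := fun g hg => pairing_eq (h_loop g hg) h_circle
      one := fun g hg => pairing_eq (h_loop g hg) h_one
      loop := fun g hg h hh => pairing_eq (h_loop g hg) (h_loop h hh) }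
  refine H.sameInvariants fun f hf => ?_
  rw [loopSum, selfArrows_eq, Finset.sum_union disjoint, h_sum f hf, zero_add]
  rfl

theorem circleIndicator_congr (h : a.1 = b.1) (i : Fin n) :
    circleIndicator i a = circleIndicator i b := by
  simp [circleIndicator, h]

theorem endpoints_ne_of_ne (hg : g ∈ β.arrows) (hh : h ∈ β.arrows) (hne : g ≠ h) :
    g.1 ≠ h.1 ∧ g.1 ≠ h.2 ∧ g.2 ≠ h.1 ∧ g.2 ≠ h.2 :=
  ⟨fun e => hne (β.tail_injOn hg hh e), β.tail_ne_head g hg h hh,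
    (β.tail_ne_head h hh g hg).symm, fun e => hne (β.head_injOn hg hh e)⟩

theorem Adjacent.loopClass_congr (adj : Adjacent β a a') (hg : g ∈ selfArrows β i)
    (htail : g.1 ≠ a) (htail' : g.1 ≠ a') (hhead : g.2 ≠ a) (hhead' : g.2 ≠ a') :
    loopClass g a = loopClass g a' := by
  obtain ⟨harrow, h1, h2⟩ := mem_selfArrows.1 hg
  exact adj.arcWeight_congr_point (h1.trans h2.symm) (tail_mem_endpoints harrow)
    (head_mem_endpoints harrow) htail htail' hhead hhead'

theorem pairing_arcWeight_circleIndicator_of_disjoint (hab : a.1 = b.1)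
    (harrow : (a, b) ∈ β.arrows ∨ (b, a) ∈ β.arrows)
    (free : Disjoint (openArc a b) β.endpoints) (i : Fin n) :
    pairing β (arcWeight a b) (circleIndicator i) = 0 := by
  have hne : a ≠ b := harrow.elim ne_of_mem_arrows fun h => (ne_of_mem_arrows h).symm
  have eqOn : Set.EqOn (arcWeight a b) (Pi.single a 1 + Pi.single b 1) β.endpoints := by
    intro z hz
    by_cases ha : z = a
    · simp [ha, hne]
    by_cases hb : z = b
    · simp [hb, hne.symm]
    simp [arcWeight_of_notMem ha hb (Set.disjoint_right.1 free hz), ha, hb]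
  rw [pairing_congr eqOn fun _ _ => rfl, map_add, LinearMap.add_apply]
  rcases harrow with h | h
  · rw [pairing_single_tail h, pairing_single_head h, circleIndicator_congr hab, add_neg_cancel]
  · rw [pairing_single_tail h, pairing_single_head h, circleIndicator_congr hab, neg_add_cancel]

theorem Adjacent.pairing_loopClass_circleIndicator (adj : Adjacent β g.1 g.2)
    (hg : g ∈ selfArrows β i) :
    pairing β (loopClass g) (circleIndicator i) = 0 ∧
      pairing β (loopClass g.swap) (circleIndicator i) = 0 := by
  have swap_eq : pairing β (loopClass g.swap) (circleIndicator i) =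
      -pairing β (loopClass g) (circleIndicator i) := by
    rw [loopClass_swap hg, map_sub, map_smul, LinearMap.sub_apply, LinearMap.smul_apply,
      pairing_self, smul_zero, zero_sub]
  suffices pairing β (loopClass g) (circleIndicator i) = 0 ∨
      pairing β (loopClass g.swap) (circleIndicator i) = 0 by grind
  have harrow := (mem_selfArrows.1 hg).1
  exact adj.2.imp
    (fun free => pairing_arcWeight_circleIndicator_of_disjoint adj.1 (.inl harrow) free i)
    (fun free => pairing_arcWeight_circleIndicator_of_disjoint adj.1.symm (.inr harrow) free i)

theorem SameInvariants.of_insert_adjacent (hg : g ∉ β.arrows) (hA : β'.arrows = insert g β.arrows)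
    (adj : Adjacent β' g.1 g.2) (i : Fin n) : SameInvariants β i β' i := by
  have hgβ' : g ∈ β'.arrows := hA ▸ Set.mem_insert g _
  refine SameInvariants.of_union (T := {g}) (P := {φ | φ g.1 = φ g.2}) (by simpa using hg)
    (by simpa using hA) rfl (circleIndicator_congr adj.1 i) (fun h hh => ?_)
    (fun φ hφ ψ hψ => ?_) fun f hf => Finset.sum_eq_zero fun h hh => ?_
  · obtain ⟨harrow, h1, h2⟩ := mem_selfArrows.1 hh
    have harrow' : h ∈ β'.arrows := hA ▸ Set.mem_insert_of_mem g harrow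
    obtain ⟨n1, n2, n3, n4⟩ := endpoints_ne_of_ne harrow' hgβ' fun e => hg (e ▸ harrow)
    exact adj.loopClass_congr (mem_selfArrows.2 ⟨harrow', h1, h2⟩) n1 n2 n3 n4
  · rw [Set.mem_ofPred_eq] at hφ hψ
    rw [Finset.sum_singleton, hφ, hψ, sub_self]
  · obtain ⟨e, h1, h2⟩ := Finset.mem_filter.1 hh
    obtain rfl := Finset.mem_singleton.1 e
    obtain ⟨h_zero, h_zero'⟩ :=
      adj.pairing_loopClass_circleIndicator (mem_selfArrows.2 ⟨hgβ', h1, h2⟩)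
    rw [hf.eq_zero _ h_zero, hf.eq_zero _ h_zero', sub_zero]

end AddedArrows

section Parallel

/-- The chords `g` and `g'` have adjacent tails and adjacent heads. -/
structure Parallel (β : VirtualString n) (g g' : CorePoint n × CorePoint n) : Prop where
  tail : Adjacent β g.1 g'.1
  head : Adjacent β g.2 g'.2
  tail_mem : g.1 ∈ β.endpoints
  tail_mem' : g'.1 ∈ β.endpoints
  head_mem : g.2 ∈ β.endpoints
  head_mem' : g'.2 ∈ β.endpoints
  tail_ne_head : g.1 ≠ g.2
  tail_ne_head' : g.1 ≠ g'.2
  tail'_ne_head : g'.1 ≠ g.2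
  tail'_ne_head' : g'.1 ≠ g'.2

variable {β β' : VirtualString n} {i : Fin n} {a a' b b' z : CorePoint n}
  {g g' : CorePoint n × CorePoint n}

namespace Parallel

theorem same' (H : Parallel β g g') (same : g.1.1 = g.2.1) : g'.1.1 = g'.2.1 :=
  H.tail.1.symm.trans (same.trans H.head.1)

theorem loopClass_tail (H : Parallel β g g') (same : g.1.1 = g.2.1) :
    loopClass g g'.1 + loopClass g' g.1 = 2 := by
  rw [← H.tail.arcWeight_left_add same H.head_mem H.tail_ne_head.symm H.tail'_ne_head.symm]
  exact congrArg _ (H.head.arcWeight_congr_right (H.head.1.trans (H.same' same).symm) H.tail_mem'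
    H.tail_mem H.tail'_ne_head H.tail'_ne_head' H.tail_ne_head H.tail_ne_head').symm

theorem loopClass_head (H : Parallel β g g') (same : g.1.1 = g.2.1) :
    loopClass g g'.2 + loopClass g' g.2 = 2 := by
  rw [← H.head.arcWeight_right_add same.symm H.tail_mem H.tail_ne_head H.tail_ne_head']
  exact congrArg _ (H.tail.arcWeight_congr_left (same.trans H.head.1) H.head_mem' H.head_mem
    H.tail_ne_head'.symm H.tail'_ne_head'.symm H.tail_ne_head.symm H.tail'_ne_head.symm).symm

theorem loopClass_eq (H : Parallel β g g') (same : g.1.1 = g.2.1) (hz : z ∈ β.endpoints)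
    (h1 : z ≠ g.1) (h2 : z ≠ g'.1) (h3 : z ≠ g.2) (h4 : z ≠ g'.2) :
    loopClass g' z = loopClass g z :=
  ((H.tail.arcWeight_congr_left same H.head_mem hz H.tail_ne_head.symm H.tail'_ne_head.symm
    h1 h2).trans (H.head.arcWeight_congr_right (H.head.1.trans (H.same' same).symm) H.tail_mem' hz
      H.tail'_ne_head H.tail'_ne_head' h3 h4)).symm

theorem loopClass_eqOn (H : Parallel β g g') (same : g.1.1 = g.2.1) :
    Set.EqOn (loopClass g') (loopClass g +
      ((loopClass g' g.1 - 1) • (Pi.single g.1 1 + Pi.single g'.1 1) +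
        (loopClass g' g.2 - 1) • (Pi.single g.2 1 + Pi.single g'.2 1))) β.endpoints := by
  intro z hz
  have eq := H.loopClass_eq same hz
  have tail := H.loopClass_tail same
  have head := H.loopClass_head same
  have values : loopClass g g.1 = 1 ∧ loopClass g g.2 = 1 ∧ loopClass g' g'.1 = 1 ∧
      loopClass g' g'.2 = 1 := by simp [loopClass]
  simp only [Pi.add_apply, Pi.smul_apply, Pi.single_apply, smul_eq_mul]
  grind [H.tail_ne_head, H.tail_ne_head', H.tail'_ne_head, H.tail'_ne_head']

theorem pairing_loopClass (H : Parallel β g g') (same : g.1.1 = g.2.1) (hg : g ∈ β.arrows)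
    (hg' : g'.swap ∈ β.arrows) (ψ : CorePoint n → ℤ) :
    pairing β (loopClass g') ψ = pairing β (loopClass g) ψ +
      ((loopClass g' g.1 - 1) * (ψ g.2 - ψ g'.2) + (loopClass g' g.2 - 1) * (ψ g'.1 - ψ g.1)) := by
  have tail' : pairing β (Pi.single g'.1 1) ψ = -ψ g'.2 := pairing_single_head hg' ψ
  have head' : pairing β (Pi.single g'.2 1) ψ = ψ g'.1 := pairing_single_tail hg' ψ
  rw [pairing_congr (H.loopClass_eqOn same) fun _ _ => rfl]
  simp only [map_add, map_smul, LinearMap.add_apply, LinearMap.smul_apply, smul_eq_mul,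
    pairing_single_tail hg, pairing_single_head hg, tail', head']
  ring

theorem samePairings (H : Parallel β g g') (hg : g ∈ selfArrows β i)
    (hg' : g'.swap ∈ selfArrows β i) : SamePairings β i (loopClass g) (loopClass g') := by
  obtain ⟨harrow, htail, hhead⟩ := mem_selfArrows.1 hg
  have same : g.1.1 = g.2.1 := htail.trans hhead.symm
  have harrow' := (mem_selfArrows.1 hg').1
  have swap' : loopClass g' = (2 : ℤ) • circleIndicator i - loopClass g'.swap := by
    simpa using loopClass_swap hg'
  have const {ψ : CorePoint n → ℤ} (tail : ψ g.1 = ψ g'.1) (head : ψ g.2 = ψ g'.2) :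
      pairing β (loopClass g) ψ = pairing β (loopClass g') ψ := by
    rw [H.pairing_loopClass same harrow harrow', tail, head]
    ring
  have circle := const (circleIndicator_congr H.tail.1 i) (circleIndicator_congr H.head.1 i)
  have self : pairing β (loopClass g') (loopClass g) = 0 := by
    rw [H.pairing_loopClass same harrow harrow', pairing_self,
      eq_sub_of_add_eq (H.loopClass_tail same), eq_sub_of_add_eq (H.loopClass_head same)]
    simp only [loopClass, arcWeight_left, arcWeight_right]
    ring
  have self' : pairing β (loopClass g) (loopClass g') = 0 := by
    rw [← neg_pairing, self, neg_zero]
  refine ⟨circle, const rfl rfl, fun h hh => ?_⟩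
  by_cases e : h = g
  · rw [e, self, pairing_self]
  by_cases e' : h = g'.swap
  · have swap : loopClass h = (2 : ℤ) • circleIndicator i - loopClass g' := by
      rw [swap', e', sub_sub_cancel]
    rw [swap, map_sub, map_sub, map_smul, map_smul, circle, pairing_self, self']
  · obtain ⟨n1, n2, n3, n4⟩ := endpoints_ne_of_ne (mem_selfArrows.1 hh).1 harrow e
    obtain ⟨n1', n2', n3', n4'⟩ := endpoints_ne_of_ne (mem_selfArrows.1 hh).1 harrow' e'
    exact const (H.tail.loopClass_congr hh n1 n2' n3 n4') (H.head.loopClass_congr hh n2 n1' n4 n3')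

theorem sum_loops_eq_zero (H : Parallel β g g') (hne : g ≠ g'.swap) (hg : g ∈ β.arrows)
    (hg' : g'.swap ∈ β.arrows) {f : (CorePoint n → ℤ) → ℤ} (hf : IsLoopFunction β i f) :
    ∑ h ∈ ({g, g'.swap} : Finset (CorePoint n × CorePoint n)) with h.1.1 = i ∧ h.2.1 = i,
      (f (loopClass h) - f (loopClass h.swap)) = 0 := by
  have hi' : g.1.1 = i ∧ g.2.1 = i ↔ g'.swap.1.1 = i ∧ g'.swap.2.1 = i := by
    rw [H.tail.1, H.head.1, Prod.fst_swap, Prod.snd_swap, and_comm]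
  by_cases hi : g.1.1 = i ∧ g.2.1 = i
  · have hself : g ∈ selfArrows β i := mem_selfArrows.2 ⟨hg, hi⟩
    have hself' : g'.swap ∈ selfArrows β i := mem_selfArrows.2 ⟨hg', hi'.1 hi⟩
    have same := H.samePairings hself hself'
    have swap' : loopClass g'.swap = (2 : ℤ) • circleIndicator i - loopClass g' := by
      rw [← Prod.swap_swap g', loopClass_swap hself', Prod.swap_swap, sub_sub_cancel]
    have same' : f (loopClass g.swap) = f (loopClass g'.swap) := by
      rw [loopClass_swap hself, swap']
      exact hf.congr _ _ same.complement
    rw [Finset.filter_true_of_mem (by simpa using ⟨hi, hi'.1 hi⟩), Finset.sum_pair hne,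
      Prod.swap_swap, hf.congr _ _ same, same', sub_add_sub_cancel, sub_self]
  · rw [Finset.filter_false_of_mem, Finset.sum_empty]
    intro h hh
    obtain rfl | rfl : h = g ∨ h = g'.swap := by simpa using hh
    exacts [hi, mt hi'.2 hi]

end Parallel

theorem SameInvariants.of_union_parallel (H : Parallel β' g g') (hne : g ≠ g'.swap)
    (hg : g ∉ β.arrows) (hg' : g'.swap ∉ β.arrows) (hA : β'.arrows = {g, g'.swap} ∪ β.arrows)
    (i : Fin n) : SameInvariants β i β' i := by
  have hgβ' : g ∈ β'.arrows := by simp [hA]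
  have hgβ'' : g'.swap ∈ β'.arrows := by simp [hA]
  refine SameInvariants.of_union (T := {g, g'.swap}) (P := {φ | φ g.1 = φ g'.1 ∧ φ g.2 = φ g'.2})
    (by simp [hg, hg']) (by simpa using hA) ⟨rfl, rfl⟩
    ⟨circleIndicator_congr H.tail.1 i, circleIndicator_congr H.head.1 i⟩ (fun h hh => ?_)
    (fun φ hφ ψ hψ => ?_) fun f hf => H.sum_loops_eq_zero hne hgβ' hgβ'' hf
  · obtain ⟨harrow, h1, h2⟩ := mem_selfArrows.1 hh
    have hβ' : h ∈ β'.arrows := hA ▸ Or.inr harrow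
    have hself : h ∈ selfArrows β' i := mem_selfArrows.2 ⟨hβ', h1, h2⟩
    obtain ⟨n1, n2, n3, n4⟩ := endpoints_ne_of_ne hβ' hgβ' fun e => hg (e ▸ harrow)
    obtain ⟨n1', n2', n3', n4'⟩ := endpoints_ne_of_ne hβ' hgβ'' fun e => hg' (e ▸ harrow)
    exact ⟨H.tail.loopClass_congr hself n1 n2' n3 n4', H.head.loopClass_congr hself n2 n1' n4 n3'⟩
  · rw [Finset.sum_pair hne, Prod.fst_swap, Prod.snd_swap, hφ.1, hφ.2, hψ.1, hψ.2]
    ring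

theorem endpoints_union {T : Set (CorePoint n × CorePoint n)} (hA : β'.arrows = T ∪ β.arrows) :
    β'.endpoints = (Prod.fst '' T ∪ Prod.snd '' T) ∪ β.endpoints := by
  simp only [endpoints, hA, Set.image_union]
  exact Set.union_union_union_comm ..

theorem notMem_arrows_of_disjoint_arc {u v : CorePoint n} (free : Disjoint (arc u v) β.endpoints)
    (hg : g.1 ∈ arc u v) : g ∉ β.arrows :=
  fun h => Set.disjoint_left.1 free hg (tail_mem_endpoints h)

theorem SameInvariants.of_isolated_arrow {u v : CorePoint n} (huv : u.1 = v.1)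
    (free : Disjoint (arc u v) β.endpoints) (hg : g = (u, v) ∨ g = (v, u))
    (hA : β'.arrows = insert g β.arrows) (i : Fin n) : SameInvariants β i β' i := by
  have free' : Disjoint (openArc u v) β'.endpoints := by
    rw [endpoints_union (T := {g}) hA, Set.disjoint_union_right]
    refine ⟨?_, free.mono_left (openArc_subset_arc u v)⟩
    rcases hg with rfl | rfl <;> simp [left_notMem_openArc, right_notMem_openArc]
  rcases hg with rfl | rfl
  · exact of_insert_adjacent (notMem_arrows_of_disjoint_arc free (left_mem_arc u v)) hA
      ⟨huv, .inl free'⟩ i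
  · exact of_insert_adjacent (notMem_arrows_of_disjoint_arc free (right_mem_arc huv)) hA
      ⟨huv.symm, .inr free'⟩ i

theorem adjacent_of_ends {u u' : CorePoint n} (ends : (u, u') = (a, a') ∨ (u, u') = (a', a))
    (same : u.1 = u'.1) (free : Disjoint (openArc u u') β.endpoints) : Adjacent β a a' := by
  rcases ends with e | e <;> obtain ⟨rfl, rfl⟩ := Prod.mk.inj e
  exacts [⟨same, .inl free⟩, ⟨same.symm, .inr free⟩]

theorem mem_arc_of_ends {u u' : CorePoint n} (ends : (u, u') = (a, a') ∨ (u, u') = (a', a))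
    (same : u.1 = u'.1) : a ∈ arc u u' ∧ a' ∈ arc u u' := by
  rcases ends with e | e <;> obtain ⟨rfl, rfl⟩ := Prod.mk.inj e
  exacts [⟨left_mem_arc _ _, right_mem_arc same⟩, ⟨right_mem_arc same, left_mem_arc _ _⟩]

theorem notMem_openArc_of_ends {u u' : CorePoint n}
    (ends : (u, u') = (a, a') ∨ (u, u') = (a', a)) : a ∉ openArc u u' ∧ a' ∉ openArc u u' := by
  rcases ends with e | e <;> obtain ⟨rfl, rfl⟩ := Prod.mk.inj e
  exacts [⟨left_notMem_openArc _ _, right_notMem_openArc _ _⟩,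
    ⟨right_notMem_openArc _ _, left_notMem_openArc _ _⟩]

theorem SameInvariants.of_bigon {u u' v v' : CorePoint n}
    (endsA : (u, u') = (a, a') ∨ (u, u') = (a', a)) (endsB : (v, v') = (b, b') ∨ (v, v') = (b', b))
    (sameA : u.1 = u'.1) (sameB : v.1 = v'.1) (freeA : Disjoint (arc u u') β.endpoints)
    (freeB : Disjoint (arc v v') β.endpoints) (disj : Disjoint (arc u u') (arc v v'))
    (hA : β'.arrows = {(a, b), (b', a')} ∪ β.arrows) (i : Fin n) : SameInvariants β i β' i := by
  obtain ⟨ha, ha'⟩ := mem_arc_of_ends endsA sameA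
  obtain ⟨hb, hb'⟩ := mem_arc_of_ends endsB sameB
  have ne {x y} : x ∈ arc u u' → y ∈ arc v v' → x ≠ y := ne_of_disjoint_arc disj
  have endpoints_eq : β'.endpoints = {b, a', a, b'} ∪ β.endpoints := by
    rw [endpoints_union hA]
    simp [Set.image_pair, Set.insert_union]
  have freeA' : Disjoint (openArc u u') β'.endpoints := by
    obtain ⟨e, e'⟩ := notMem_openArc_of_ends endsA
    have off {y} (hy : y ∈ arc v v') : y ∉ openArc u u' :=
      fun h => ne (openArc_subset_arc u u' h) hy rfl
    rw [endpoints_eq, Set.disjoint_union_right]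
    exact ⟨Set.disjoint_right.2 (by simp [off hb, off hb', e, e']),
      freeA.mono_left (openArc_subset_arc u u')⟩
  have freeB' : Disjoint (openArc v v') β'.endpoints := by
    obtain ⟨e, e'⟩ := notMem_openArc_of_ends endsB
    have off {y} (hy : y ∈ arc u u') : y ∉ openArc v v' :=
      fun h => ne hy (openArc_subset_arc v v' h) rfl
    rw [endpoints_eq, Set.disjoint_union_right]
    exact ⟨Set.disjoint_right.2 (by simp [off ha, off ha', e, e']),
      freeB.mono_left (openArc_subset_arc v v')⟩
  have H : Parallel β' (a, b) (a', b') :=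
    { tail := adjacent_of_ends endsA sameA freeA'
      head := adjacent_of_ends endsB sameB freeB'
      tail_mem := by simp [endpoints_eq]
      tail_mem' := by simp [endpoints_eq]
      head_mem := by simp [endpoints_eq]
      head_mem' := by simp [endpoints_eq]
      tail_ne_head := ne ha hb
      tail_ne_head' := ne ha hb'
      tail'_ne_head := ne ha' hb
      tail'_ne_head' := ne ha' hb' }
  exact of_union_parallel H (fun e => ne ha hb' (congrArg Prod.fst e))
    (notMem_arrows_of_disjoint_arc freeA ha) (notMem_arrows_of_disjoint_arc freeB hb') hA i

end Parallel

section Involution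

/-- An involution of the core circles that moves points only to adjacent points and maps the
endpoints of arrows to endpoints of arrows. -/
structure AdjacentInvolution (β : VirtualString n) (τ : CorePoint n → CorePoint n) : Prop where
  involutive : Function.Involutive τ
  adjacent : ∀ z, Adjacent β z (τ z)
  mem_endpoints : ∀ z ∈ β.endpoints, τ z ∈ β.endpoints

/-- The difference, at the endpoints of arrows, between the loop of `τ g` pulled back along an
adjacent involution `τ` and the loop of `g`. -/
noncomputable def loopShift (τ : CorePoint n → CorePoint n) (g : CorePoint n × CorePoint n) :
    CorePoint n → ℤ :=
  (2 * (loopClass (Prod.map τ τ g) g.1 - 1)) • Pi.single (τ g.1) 1 +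
    (2 * (loopClass (Prod.map τ τ g) g.2 - 1)) • Pi.single (τ g.2) 1

variable {β β' : VirtualString n} {i : Fin n} {τ : CorePoint n → CorePoint n}
  {g h e₁ e₂ e₃ : CorePoint n × CorePoint n}

theorem pairing_loopShift (β : VirtualString n) (τ : CorePoint n → CorePoint n)
    (g : CorePoint n × CorePoint n) (ψ : CorePoint n → ℤ) :
    pairing β (loopShift τ g) ψ =
      2 * (loopClass (Prod.map τ τ g) g.1 - 1) * pairing β (Pi.single (τ g.1) 1) ψ +
        2 * (loopClass (Prod.map τ τ g) g.2 - 1) * pairing β (Pi.single (τ g.2) 1) ψ := by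
  simp only [loopShift, map_add, map_smul, LinearMap.add_apply, LinearMap.smul_apply, smul_eq_mul]

theorem loopShift_of_fixed (htail : τ g.1 = g.1) (hhead : τ g.2 = g.2) : loopShift τ g = 0 := by
  simp [loopShift, loopClass, htail, hhead]

/-- The moves of the ends of the self-arrows `g` and `h` along `τ` change the intersection number of
their loops by opposite amounts. -/
def ShiftsCompatible (β : VirtualString n) (i : Fin n) (τ : CorePoint n → CorePoint n)
    (g h : CorePoint n × CorePoint n) : Prop :=
  g ∈ selfArrows β i → h ∈ selfArrows β i →
    pairing β (loopShift τ g) (loopClass (Prod.map τ τ h) ∘ τ) =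
      pairing β (loopShift τ h) (loopClass g)

theorem forall_mem_triple_of_cyclic {α : Type*} {r : α → α → Prop} {a b c : α}
    (refl : ∀ x, r x x) (symm : ∀ x y, r x y → r y x) (hab : r a b) (hbc : r b c) (hca : r c a) :
    ∀ x ∈ ({a, b, c} : Set α), ∀ y ∈ ({a, b, c} : Set α), r x y := by
  rintro x (rfl | rfl | rfl) y (rfl | rfl | rfl)
  exacts [refl _, hab, symm _ _ hca, symm _ _ hab, refl _, hbc, hca, symm _ _ hbc, refl _]

theorem image_arrows_of_triple (old : {e₁, e₂, e₃} ⊆ β.arrows)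
    (fixed : ∀ g ∈ β.arrows, g ∉ ({e₁, e₂, e₃} : Set _) → τ g.1 = g.1 ∧ τ g.2 = g.2) :
    Prod.map τ τ '' β.arrows = (β.arrows \ {e₁, e₂, e₃}) ∪
      {Prod.map τ τ e₁, Prod.map τ τ e₂, Prod.map τ τ e₃} := by
  have rest : Prod.map τ τ '' (β.arrows \ {e₁, e₂, e₃}) = β.arrows \ {e₁, e₂, e₃} :=
    (Set.image_congr fun g hg => Prod.ext (fixed g hg.1 hg.2).1 (fixed g hg.1 hg.2).2).trans
      (Set.image_id _)
  conv_lhs => rw [← Set.sdiff_union_of_subset old, Set.image_union, rest]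
  simp only [Set.image_insert_eq, Set.image_singleton]

namespace AdjacentInvolution

theorem fst_eq (H : AdjacentInvolution β τ) (z : CorePoint n) : (τ z).1 = z.1 :=
  (H.adjacent z).1.symm

theorem circleIndicator_comp (H : AdjacentInvolution β τ) (i : Fin n) :
    circleIndicator i ∘ τ = circleIndicator i :=
  funext fun z => circleIndicator_congr (H.fst_eq z) i

theorem parallel (H : AdjacentInvolution β τ) (hg : g ∈ β.arrows) (hne : τ g.1 ≠ g.2) :
    Parallel β g (Prod.map τ τ g) where
  tail := H.adjacent g.1
  head := H.adjacent g.2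
  tail_mem := tail_mem_endpoints hg
  tail_mem' := H.mem_endpoints _ (tail_mem_endpoints hg)
  head_mem := head_mem_endpoints hg
  head_mem' := H.mem_endpoints _ (head_mem_endpoints hg)
  tail_ne_head := ne_of_mem_arrows hg
  tail_ne_head' e := hne (H.involutive.eq_iff.2 e)
  tail'_ne_head := hne
  tail'_ne_head' e := ne_of_mem_arrows hg (H.involutive.injective e)

theorem loopClass_comp_eqOn (H : AdjacentInvolution β τ) (hg : g ∈ selfArrows β i)
    (hne : τ g.1 ≠ g.2) :
    Set.EqOn (loopClass (Prod.map τ τ g) ∘ τ) (loopClass g + loopShift τ g) β.endpoints := by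
  intro z hz
  obtain ⟨harrow, h1, h2⟩ := mem_selfArrows.1 hg
  have same : g.1.1 = g.2.1 := h1.trans h2.symm
  have P := H.parallel harrow hne
  have tail := P.loopClass_tail same
  have head := P.loopClass_head same
  have eq := P.loopClass_eq same hz
  have move : z ≠ g.1 → z ≠ τ g.1 → z ≠ g.2 → z ≠ τ g.2 →
      loopClass (Prod.map τ τ g) (τ z) = loopClass (Prod.map τ τ g) z := fun n1 n2 n3 n4 =>
    ((H.adjacent z).arcWeight_congr_point (P.same' same) P.tail_mem' P.head_mem' n2.symm
      (fun e => n1 (H.involutive.injective e).symm) n4.symm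
      (fun e => n3 (H.involutive.injective e).symm)).symm
  have values : loopClass g g.1 = 1 ∧ loopClass g g.2 = 1 ∧
      loopClass (Prod.map τ τ g) (τ g.1) = 1 ∧ loopClass (Prod.map τ τ g) (τ g.2) = 1 := by
    simp [loopClass]
  have inv := H.involutive
  simp only [loopShift, Function.comp, Pi.add_apply, Pi.smul_apply, Pi.single_apply, smul_eq_mul]
  simp only [Prod.map_fst, Prod.map_snd] at tail head eq
  by_cases e1 : z = g.1 <;> by_cases e2 : z = g.2 <;>
    grind [P.tail_ne_head, P.tail_ne_head', P.tail'_ne_head, P.tail'_ne_head', inv z, inv g.1,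
      inv g.2]

theorem pairing_loopClass_comp (H : AdjacentInvolution β τ) (hg : g ∈ selfArrows β i)
    (hne : τ g.1 ≠ g.2) (ψ : CorePoint n → ℤ) :
    pairing β (loopClass (Prod.map τ τ g) ∘ τ) ψ =
      pairing β (loopClass g) ψ + pairing β (loopShift τ g) ψ := by
  rw [pairing_congr (H.loopClass_comp_eqOn hg hne) fun _ _ => rfl, map_add, LinearMap.add_apply]

theorem pairing_loopClass_comp_comp (H : AdjacentInvolution β τ) (hg : g ∈ selfArrows β i)
    (hh : h ∈ selfArrows β i) (hne : τ g.1 ≠ g.2) (hne' : τ h.1 ≠ h.2)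
    (compat : ShiftsCompatible β i τ g h) :
    pairing β (loopClass (Prod.map τ τ g) ∘ τ) (loopClass (Prod.map τ τ h) ∘ τ) =
      pairing β (loopClass g) (loopClass h) := by
  rw [H.pairing_loopClass_comp hg hne, compat hg hh, ← neg_pairing,
    H.pairing_loopClass_comp hh hne', neg_add, neg_pairing, neg_add_cancel_right]

theorem sameInvariants (H : AdjacentInvolution β τ) (hA : β'.arrows = Prod.map τ τ '' β.arrows)
    (invariant : ∀ g ∈ selfArrows β i, ∀ ψ, Set.EqOn (ψ ∘ τ) ψ β.endpoints →
      pairing β (loopClass (Prod.map τ τ g) ∘ τ) ψ = pairing β (loopClass g) ψ)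
    (loop : ∀ g ∈ selfArrows β i, ∀ h ∈ selfArrows β i,
      pairing β (loopClass (Prod.map τ τ g) ∘ τ) (loopClass (Prod.map τ τ h) ∘ τ) =
        pairing β (loopClass g) (loopClass h)) :
    SameInvariants β i β' i := by
  have hτ := H.involutive.injective
  have fst_eq_iff (z) : (τ z).1 = i ↔ z.1 = i := by rw [H.fst_eq]
  have circle := H.circleIndicator_comp i
  have preserves : PreservesLoops β i β' i τ :=
    { mem := fun g hg => map_mem_selfArrows fst_eq_iff hA hg
      circleIndex_eq := by rw [circleIndex, pairing_image hτ hA, circle]; rfl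
      circle := fun g hg => by
        rw [pairing_image hτ hA, circle, invariant g hg _ fun z _ => congrFun circle z]
      one := fun g hg => by rw [pairing_image hτ hA]; exact invariant g hg 1 fun _ _ => rfl
      loop := fun g hg h hh => by rw [pairing_image hτ hA, loop g hg h hh] }
  exact preserves.sameInvariants_of_image hτ fst_eq_iff hA

theorem sameInvariants_of_triple (H : AdjacentInvolution β τ) (old : {e₁, e₂, e₃} ⊆ β.arrows)
    (fixed : ∀ g ∈ β.arrows, g ∉ ({e₁, e₂, e₃} : Set _) → τ g.1 = g.1 ∧ τ g.2 = g.2)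
    (hne : ∀ g ∈ ({e₁, e₂, e₃} : Set _), τ g.1 ≠ g.2)
    (hA : β'.arrows = (β.arrows \ {e₁, e₂, e₃}) ∪
      {Prod.map τ τ e₁, Prod.map τ τ e₂, Prod.map τ τ e₃})
    (shift : ∀ g ∈ ({e₁, e₂, e₃} : Set _), g ∈ selfArrows β i →
      ∀ ψ, Set.EqOn (ψ ∘ τ) ψ β.endpoints → pairing β (loopShift τ g) ψ = 0)
    (compat₁ : ShiftsCompatible β i τ e₁ e₂) (compat₂ : ShiftsCompatible β i τ e₂ e₃)
    (compat₃ : ShiftsCompatible β i τ e₃ e₁) : SameInvariants β i β' i := by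
  have hA : β'.arrows = Prod.map τ τ '' β.arrows := hA.trans (image_arrows_of_triple old fixed).symm
  have hne (g) (hg : g ∈ selfArrows β i) : τ g.1 ≠ g.2 := by
    by_cases he : g ∈ ({e₁, e₂, e₃} : Set _)
    · exact hne g he
    · obtain ⟨harrow, -⟩ := mem_selfArrows.1 hg
      rw [(fixed g harrow he).1]
      exact ne_of_mem_arrows harrow
  have fixed {g} (hg : g ∈ selfArrows β i) := fixed g (mem_selfArrows.1 hg).1
  have shift (g) (hg : g ∈ selfArrows β i) (ψ) (hψ : Set.EqOn (ψ ∘ τ) ψ β.endpoints) :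
      pairing β (loopShift τ g) ψ = 0 := by
    by_cases he : g ∈ ({e₁, e₂, e₃} : Set _)
    · exact shift g he hg ψ hψ
    · rw [loopShift_of_fixed (fixed hg he).1 (fixed hg he).2, map_zero, LinearMap.zero_apply]
  have invariant (g) (hg : g ∈ selfArrows β i) (ψ) (hψ : Set.EqOn (ψ ∘ τ) ψ β.endpoints) :
      pairing β (loopClass (Prod.map τ τ g) ∘ τ) ψ = pairing β (loopClass g) ψ := by
    rw [H.pairing_loopClass_comp hg (hne g hg), shift g hg ψ hψ, add_zero]
  let Preserved (g h) : Prop := g ∈ selfArrows β i → h ∈ selfArrows β i →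
    pairing β (loopClass (Prod.map τ τ g) ∘ τ) (loopClass (Prod.map τ τ h) ∘ τ) =
      pairing β (loopClass g) (loopClass h)
  have symm (g h) (e : Preserved g h) : Preserved h g := fun hh hg => by
    rw [← neg_pairing, e hg hh, neg_pairing]
  have of_compat {g h} (e : ShiftsCompatible β i τ g h) : Preserved g h := fun hg hh =>
    H.pairing_loopClass_comp_comp hg hh (hne g hg) (hne h hh) e
  have of_fixed (g h) (he : h ∉ ({e₁, e₂, e₃} : Set _)) : Preserved g h :=
    of_compat fun hg hh => by
      have shift_eq := loopShift_of_fixed (fixed hh he).1 (fixed hh he).2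
      have map_eq : Prod.map τ τ h = h := Prod.ext (fixed hh he).1 (fixed hh he).2
      rw [shift_eq, map_zero, LinearMap.zero_apply]
      refine shift g hg _ fun z hz => ?_
      rw [H.loopClass_comp_eqOn hh (hne h hh) hz, shift_eq, add_zero, map_eq, Function.comp,
        Function.comp, H.involutive z]
  have of_mem := forall_mem_triple_of_cyclic (r := Preserved)
    (fun _ _ _ => by rw [pairing_self, pairing_self]) symm (of_compat compat₁) (of_compat compat₂)
    (of_compat compat₃)
  refine H.sameInvariants hA invariant fun g hg h hh => ?_
  by_cases he : g ∈ ({e₁, e₂, e₃} : Set _)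
  · by_cases he' : h ∈ ({e₁, e₂, e₃} : Set _)
    · exact of_mem g he h he' hg hh
    · exact of_fixed g h he' hg hh
  · exact symm _ _ (of_fixed h g he) hg hh

end AdjacentInvolution

end Involution

section Triangle

/-- The involution `τ` swaps the two ends of each of three disjoint arcs without endpoints of arrows
in their interiors, and fixes all other points. -/
structure TriangleSwap (β : VirtualString n) (τ : CorePoint n → CorePoint n)
    (a a' b b' c c' : CorePoint n) : Prop where
  involutive : Function.Involutive τ
  mapA : τ a = a'
  mapB : τ b = b'
  mapC : τ c = c'
  fixed : ∀ z, z ∉ ({a, a', b, b', c, c'} : Set _) → τ z = z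
  sameA : a.1 = a'.1
  sameB : b.1 = b'.1
  sameC : c.1 = c'.1
  freeA : Disjoint (openArc a a') β.endpoints
  freeB : Disjoint (openArc b b') β.endpoints
  freeC : Disjoint (openArc c c') β.endpoints
  disjAB : Disjoint (arc a a') (arc b b')
  disjBC : Disjoint (arc b b') (arc c c')
  disjCA : Disjoint (arc c c') (arc a a')
  mem : {a, a', b, b', c, c'} ⊆ β.endpoints

variable {β β' : VirtualString n} {i : Fin n} {τ : CorePoint n → CorePoint n}
  {a a' b b' c c' : CorePoint n}

theorem exists_triangleSwap (sameA : a.1 = a'.1) (sameB : b.1 = b'.1) (sameC : c.1 = c'.1)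
    (freeA : Disjoint (openArc a a') β.endpoints) (freeB : Disjoint (openArc b b') β.endpoints)
    (freeC : Disjoint (openArc c c') β.endpoints) (disjAB : Disjoint (arc a a') (arc b b'))
    (disjBC : Disjoint (arc b b') (arc c c')) (disjCA : Disjoint (arc c c') (arc a a'))
    (mem : {a, a', b, b', c, c'} ⊆ β.endpoints) :
    ∃ τ, TriangleSwap β τ a a' b b' c c' := by
  classical
  have neAB {x y} : x ∈ arc a a' → y ∈ arc b b' → x ≠ y := ne_of_disjoint_arc disjAB
  have neBC {x y} : x ∈ arc b b' → y ∈ arc c c' → x ≠ y := ne_of_disjoint_arc disjBC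
  have neCA {x y} : x ∈ arc c c' → y ∈ arc a a' → x ≠ y := ne_of_disjoint_arc disjCA
  have la := left_mem_arc a a'
  have lb := left_mem_arc b b'
  have lc := left_mem_arc c c'
  have ra := right_mem_arc sameA
  have rb := right_mem_arc sameB
  have rc := right_mem_arc sameC
  refine ⟨Equiv.swap a a' * (Equiv.swap b b' * Equiv.swap c c'), ?_, ?_, ?_, ?_, ?_, sameA, sameB,
    sameC, freeA, freeB, freeC, disjAB, disjBC, disjCA, mem⟩
  · intro z
    simp only [Equiv.Perm.coe_mul, Function.comp, Equiv.swap_apply_def]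
    grind
  all_goals
    simp only [Equiv.Perm.coe_mul, Function.comp, Equiv.swap_apply_def]
    grind

namespace TriangleSwap

theorem mapA' (H : TriangleSwap β τ a a' b b' c c') : τ a' = a := by
  rw [← H.mapA, H.involutive]

theorem rotate (H : TriangleSwap β τ a a' b b' c c') : TriangleSwap β τ b b' c c' a a' where
  involutive := H.involutive
  mapA := H.mapB
  mapB := H.mapC
  mapC := H.mapA
  fixed z hz := H.fixed z (by grind)
  sameA := H.sameB
  sameB := H.sameC
  sameC := H.sameA
  freeA := H.freeB
  freeB := H.freeC
  freeC := H.freeA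
  disjAB := H.disjBC
  disjBC := H.disjCA
  disjCA := H.disjAB
  mem z hz := H.mem (by grind)

theorem mapB' (H : TriangleSwap β τ a a' b b' c c') : τ b' = b := H.rotate.mapA'

theorem mapC' (H : TriangleSwap β τ a a' b b' c c') : τ c' = c := H.rotate.mapB'

theorem adjacentInvolution (H : TriangleSwap β τ a a' b b' c c') : AdjacentInvolution β τ where
  involutive := H.involutive
  adjacent z := by
    by_cases hz : z ∈ ({a, a', b, b', c, c'} : Set _)
    · rcases hz with rfl | rfl | rfl | rfl | rfl | rfl
      · exact H.mapA ▸ ⟨H.sameA, .inl H.freeA⟩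
      · exact H.mapA' ▸ ⟨H.sameA.symm, .inr H.freeA⟩
      · exact H.mapB ▸ ⟨H.sameB, .inl H.freeB⟩
      · exact H.mapB' ▸ ⟨H.sameB.symm, .inr H.freeB⟩
      · exact H.mapC ▸ ⟨H.sameC, .inl H.freeC⟩
      · exact H.mapC' ▸ ⟨H.sameC.symm, .inr H.freeC⟩
    · rw [H.fixed z hz]
      exact .refl β z
  mem_endpoints z hz := by
    by_cases hz' : z ∈ ({a, a', b, b', c, c'} : Set _)
    · rcases hz' with rfl | rfl | rfl | rfl | rfl | rfl <;> refine H.mem ?_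
      all_goals simp [H.mapA, H.mapB, H.mapC, H.mapA', H.mapB', H.mapC']
    · rwa [H.fixed z hz']

theorem pairing_loopShift_cyclic (H : TriangleSwap β τ a a' b b' c c') (same : a.1 = b.1)
    (hb : (b', c) ∈ β.arrows) (hc : (c', a) ∈ β.arrows) (ψ : CorePoint n → ℤ) :
    pairing β (loopShift τ (a', b)) ψ = 2 * (ψ c - ψ c') := by
  have tail : loopClass (a, b') a' = 2 := arcWeight_left_end H.sameA (same.trans H.sameB)
    (Set.disjoint_right.1 H.disjAB (right_mem_arc H.sameB))
  have head : loopClass (a, b') b = 2 := arcWeight_right_start same.symm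
    (Set.disjoint_left.1 H.disjAB (left_mem_arc a a'))
  have pairing_a : pairing β (Pi.single a 1) ψ = -ψ c' := pairing_single_head hc ψ
  have pairing_b' : pairing β (Pi.single b' 1) ψ = ψ c := pairing_single_tail hb ψ
  rw [pairing_loopShift, Prod.map_apply, H.mapA', H.mapB, tail, head, pairing_a, pairing_b']
  ring

theorem shiftsCompatible_cyclic (H : TriangleSwap β τ a a' b b' c c')
    (ha : (a', b) ∈ β.arrows) (hb : (b', c) ∈ β.arrows) (hc : (c', a) ∈ β.arrows) :
    ShiftsCompatible β i τ (a', b) (b', c) := by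
  intro hg hh
  obtain ⟨-, ga, gb⟩ := mem_selfArrows.1 hg
  obtain ⟨-, -, hc_self⟩ := mem_selfArrows.1 hh
  have same_ab : a.1 = b.1 := H.sameA.trans (ga.trans gb.symm)
  have same_bc : b.1 = c.1 := gb.trans hc_self.symm
  have value_h : loopClass (b, c') c = 2 := arcWeight_right_start same_bc.symm
    (Set.disjoint_left.1 H.disjBC (left_mem_arc b b'))
  have value_g : loopClass (a', b) a = 0 := arcWeight_left_start H.sameA same_ab
    (Set.disjoint_right.1 H.disjAB (left_mem_arc b b'))
  rw [H.pairing_loopShift_cyclic same_ab hb hc, H.rotate.pairing_loopShift_cyclic same_bc hc ha,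
    Prod.map_apply, H.mapB', H.mapC, Function.comp, H.mapC, Function.comp, H.mapC', value_h,
    value_g]
  simp [loopClass]

theorem sameInvariants_cyclic (H : TriangleSwap β τ a a' b b' c c')
    (old : {(a', b), (b', c), (c', a)} ⊆ β.arrows)
    (hA : β'.arrows = (β.arrows \ {(a', b), (b', c), (c', a)}) ∪ {(a, b'), (b, c'), (c, a')})
    (i : Fin n) : SameInvariants β i β' i := by
  have ha : (a', b) ∈ β.arrows := old (by simp)
  have hb : (b', c) ∈ β.arrows := old (by simp)
  have hc : (c', a) ∈ β.arrows := old (by simp)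
  have shift {x x' y y' z z'} (T : TriangleSwap β τ x x' y y' z z') (hx : (x', y) ∈ selfArrows β i)
      (hy : (y', z) ∈ β.arrows) (hz : (z', x) ∈ β.arrows) (ψ)
      (hψ : Set.EqOn (ψ ∘ τ) ψ β.endpoints) : pairing β (loopShift τ (x', y)) ψ = 0 := by
    obtain ⟨-, h1, h2⟩ := mem_selfArrows.1 hx
    have eq : ψ z' = ψ z := T.mapC ▸ hψ (head_mem_endpoints hy)
    rw [T.pairing_loopShift_cyclic (T.sameA.trans (h1.trans h2.symm)) hy hz, eq, sub_self, mul_zero]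
  refine H.adjacentInvolution.sameInvariants_of_triple old (fun g hg hne => ?_) ?_
    (by simpa only [Prod.map_apply, H.mapA, H.mapA', H.mapB, H.mapB', H.mapC, H.mapC'] using hA) ?_
    (H.shiftsCompatible_cyclic ha hb hc) (H.rotate.shiftsCompatible_cyclic hb hc ha)
    (H.rotate.rotate.shiftsCompatible_cyclic hc ha hb)
  · have ea := endpoints_ne_of_ne hg ha (by grind)
    have eb := endpoints_ne_of_ne hg hb (by grind)
    have ec := endpoints_ne_of_ne hg hc (by grind)
    exact ⟨H.fixed _ (by grind), H.fixed _ (by grind)⟩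
  · have ab := ne_of_disjoint_arc H.disjAB (left_mem_arc a a') (left_mem_arc b b')
    have bc := ne_of_disjoint_arc H.disjBC (left_mem_arc b b') (left_mem_arc c c')
    have ca := ne_of_disjoint_arc H.disjCA (left_mem_arc c c') (left_mem_arc a a')
    rintro g (rfl | rfl | rfl)
    exacts [H.mapA'.trans_ne ab, H.mapB'.trans_ne bc, H.mapC'.trans_ne ca]
  · rintro g (rfl | rfl | rfl) hself
    exacts [shift H hself hb hc, shift H.rotate hself hc ha, shift H.rotate.rotate hself ha hb]

theorem pairing_loopShift_linear₁ (H : TriangleSwap β τ a a' b b' c c') (same : a.1 = b.1)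
    (hh : (a', c) ∈ β.arrows) (hk : (b', c') ∈ β.arrows) (ψ : CorePoint n → ℤ) :
    pairing β (loopShift τ (a, b)) ψ = 2 * (ψ c' - ψ c) := by
  have tail : loopClass (a', b') a = 0 := arcWeight_left_start H.sameA (same.trans H.sameB)
    (Set.disjoint_right.1 H.disjAB (right_mem_arc H.sameB))
  have head : loopClass (a', b') b = 2 := arcWeight_right_start (same.symm.trans H.sameA)
    (Set.disjoint_left.1 H.disjAB (right_mem_arc H.sameA))
  have pairing_a' : pairing β (Pi.single a' 1) ψ = ψ c := pairing_single_tail hh ψ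
  have pairing_b' : pairing β (Pi.single b' 1) ψ = ψ c' := pairing_single_tail hk ψ
  rw [pairing_loopShift, Prod.map_apply, H.mapA, H.mapB, tail, head, pairing_a', pairing_b']
  ring

theorem pairing_loopShift_linear₂ (H : TriangleSwap β τ a a' b b' c c') (same : a.1 = c.1)
    (hg : (a, b) ∈ β.arrows) (hk : (b', c') ∈ β.arrows) (ψ : CorePoint n → ℤ) :
    pairing β (loopShift τ (a', c)) ψ = 2 * (ψ b - ψ b') := by
  have tail : loopClass (a, c') a' = 2 := arcWeight_left_end H.sameA (same.trans H.sameC)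
    (Set.disjoint_left.1 H.disjCA (right_mem_arc H.sameC))
  have head : loopClass (a, c') c = 2 := arcWeight_right_start same.symm
    (Set.disjoint_right.1 H.disjCA (left_mem_arc a a'))
  have pairing_a : pairing β (Pi.single a 1) ψ = ψ b := pairing_single_tail hg ψ
  have pairing_c' : pairing β (Pi.single c' 1) ψ = -ψ b' := pairing_single_head hk ψ
  rw [pairing_loopShift, Prod.map_apply, H.mapA', H.mapC, tail, head, pairing_a, pairing_c']
  ring

theorem pairing_loopShift_linear₃ (H : TriangleSwap β τ a a' b b' c c') (same : b.1 = c.1)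
    (hg : (a, b) ∈ β.arrows) (hh : (a', c) ∈ β.arrows) (ψ : CorePoint n → ℤ) :
    pairing β (loopShift τ (b', c')) ψ = 2 * (ψ a' - ψ a) := by
  have tail : loopClass (b, c) b' = 2 := arcWeight_left_end H.sameB same
    (Set.disjoint_right.1 H.disjBC (left_mem_arc c c'))
  have head : loopClass (b, c) c' = 0 := arcWeight_right_end H.sameC same.symm
    (Set.disjoint_left.1 H.disjBC (left_mem_arc b b'))
  have pairing_b : pairing β (Pi.single b 1) ψ = -ψ a := pairing_single_head hg ψ
  have pairing_c : pairing β (Pi.single c 1) ψ = -ψ a' := pairing_single_head hh ψ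
  rw [pairing_loopShift, Prod.map_apply, H.mapB', H.mapC', tail, head, pairing_b, pairing_c]
  ring

theorem shiftsCompatible_linear₁₂ (H : TriangleSwap β τ a a' b b' c c')
    (hg : (a, b) ∈ β.arrows) (hh : (a', c) ∈ β.arrows) (hk : (b', c') ∈ β.arrows) :
    ShiftsCompatible β i τ (a, b) (a', c) := by
  intro hg_self hh_self
  obtain ⟨-, ga, gb⟩ := mem_selfArrows.1 hg_self
  obtain ⟨-, -, hc⟩ := mem_selfArrows.1 hh_self
  have same_ab : a.1 = b.1 := ga.trans gb.symm
  have same_ac : a.1 = c.1 := ga.trans hc.symm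
  have value_h : loopClass (a, c') c = 2 := arcWeight_right_start same_ac.symm
    (Set.disjoint_right.1 H.disjCA (left_mem_arc a a'))
  have value_g : loopClass (a, b) b' = 0 := arcWeight_right_end H.sameB same_ab.symm
    (Set.disjoint_left.1 H.disjAB (left_mem_arc a a'))
  rw [H.pairing_loopShift_linear₁ same_ab hh hk, H.pairing_loopShift_linear₂ same_ac hg hk,
    Prod.map_apply, H.mapA', H.mapC, Function.comp, H.mapC', Function.comp, H.mapC, value_h,
    value_g]
  simp [loopClass]

theorem shiftsCompatible_linear₂₃ (H : TriangleSwap β τ a a' b b' c c')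
    (hg : (a, b) ∈ β.arrows) (hh : (a', c) ∈ β.arrows) (hk : (b', c') ∈ β.arrows) :
    ShiftsCompatible β i τ (a', c) (b', c') := by
  intro hh_self hk_self
  obtain ⟨-, ha', hc⟩ := mem_selfArrows.1 hh_self
  obtain ⟨-, kb', -⟩ := mem_selfArrows.1 hk_self
  have same_ac : a.1 = c.1 := H.sameA.trans (ha'.trans hc.symm)
  have same_bc : b.1 = c.1 := H.sameB.trans (kb'.trans hc.symm)
  have value_k : loopClass (b, c) b' = 2 := arcWeight_left_end H.sameB same_bc
    (Set.disjoint_right.1 H.disjBC (left_mem_arc c c'))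
  have value_h : loopClass (a', c) a = 0 := arcWeight_left_start H.sameA same_ac
    (Set.disjoint_left.1 H.disjCA (left_mem_arc c c'))
  rw [H.pairing_loopShift_linear₂ same_ac hg hk, H.pairing_loopShift_linear₃ same_bc hg hh,
    Prod.map_apply, H.mapB', H.mapC', Function.comp, H.mapB, Function.comp, H.mapB', value_k,
    value_h]
  simp [loopClass]

theorem shiftsCompatible_linear₃₁ (H : TriangleSwap β τ a a' b b' c c')
    (hg : (a, b) ∈ β.arrows) (hh : (a', c) ∈ β.arrows) (hk : (b', c') ∈ β.arrows) :
    ShiftsCompatible β i τ (b', c') (a, b) := by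
  intro hk_self hg_self
  obtain ⟨-, ga, gb⟩ := mem_selfArrows.1 hg_self
  obtain ⟨-, -, kc'⟩ := mem_selfArrows.1 hk_self
  have same_ab : a.1 = b.1 := ga.trans gb.symm
  have same_bc : b.1 = c.1 := gb.trans (H.sameC.trans kc').symm
  have value_g : loopClass (a', b') a = 0 := arcWeight_left_start H.sameA (same_ab.trans H.sameB)
    (Set.disjoint_right.1 H.disjAB (right_mem_arc H.sameB))
  have value_k : loopClass (b', c') c = 2 := arcWeight_right_start (same_bc.symm.trans H.sameB)
    (Set.disjoint_left.1 H.disjBC (right_mem_arc H.sameB))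
  rw [H.pairing_loopShift_linear₃ same_bc hg hh, H.pairing_loopShift_linear₁ same_ab hh hk,
    Prod.map_apply, H.mapA, H.mapB, Function.comp, H.mapA', Function.comp, H.mapA, value_g,
    value_k]
  simp [loopClass]

theorem sameInvariants_linear (H : TriangleSwap β τ a a' b b' c c')
    (old : {(a, b), (a', c), (b', c')} ⊆ β.arrows)
    (hA : β'.arrows = (β.arrows \ {(a, b), (a', c), (b', c')}) ∪ {(a', b'), (a, c'), (b, c)})
    (i : Fin n) : SameInvariants β i β' i := by
  have hg : (a, b) ∈ β.arrows := old (by simp)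
  have hh : (a', c) ∈ β.arrows := old (by simp)
  have hk : (b', c') ∈ β.arrows := old (by simp)
  refine H.adjacentInvolution.sameInvariants_of_triple old (fun e he hne => ?_) ?_
    (by simpa only [Prod.map_apply, H.mapA, H.mapA', H.mapB, H.mapB', H.mapC, H.mapC'] using hA) ?_
    (H.shiftsCompatible_linear₁₂ hg hh hk) (H.shiftsCompatible_linear₂₃ hg hh hk)
    (H.shiftsCompatible_linear₃₁ hg hh hk)
  · have eg := endpoints_ne_of_ne he hg (by grind)
    have eh := endpoints_ne_of_ne he hh (by grind)
    have ek := endpoints_ne_of_ne he hk (by grind)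
    exact ⟨H.fixed _ (by grind), H.fixed _ (by grind)⟩
  · have ab := ne_of_disjoint_arc H.disjAB (right_mem_arc H.sameA) (left_mem_arc b b')
    have ca := ne_of_disjoint_arc H.disjCA (left_mem_arc c c') (left_mem_arc a a')
    have bc := ne_of_disjoint_arc H.disjBC (left_mem_arc b b') (right_mem_arc H.sameC)
    rintro e (rfl | rfl | rfl)
    exacts [H.mapA.trans_ne ab, H.mapA'.trans_ne ca.symm, H.mapB'.trans_ne bc]
  · rintro e (rfl | rfl | rfl) e_self ψ hψ <;>
      obtain ⟨-, tail_i, head_i⟩ := mem_selfArrows.1 e_self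
    · have eq : ψ c' = ψ c := H.mapC ▸ hψ (head_mem_endpoints hh)
      rw [H.pairing_loopShift_linear₁ (tail_i.trans head_i.symm) hh hk, eq, sub_self, mul_zero]
    · have eq : ψ b' = ψ b := H.mapB ▸ hψ (head_mem_endpoints hg)
      rw [H.pairing_loopShift_linear₂ (H.sameA.trans (tail_i.trans head_i.symm)) hg hk, eq,
        sub_self, mul_zero]
    · have eq : ψ a' = ψ a := H.mapA ▸ hψ (tail_mem_endpoints hg)
      rw [H.pairing_loopShift_linear₃ (H.sameB.trans (tail_i.trans head_i.symm) |>.trans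
        H.sameC.symm) hg hh, eq, sub_self, mul_zero]

end TriangleSwap

end Triangle

theorem Move.sameInvariants {β β' : VirtualString n} (h : Move β β') (i : Fin n) :
    SameInvariants β i β' i := by
  cases h with
  | type1a a b same free add_arrow =>
    exact .of_isolated_arrow same free (.inl rfl) add_arrow i
  | type1b a b same free add_arrow =>
    exact .of_isolated_arrow same free (.inr rfl) add_arrow i
  | type2 a a' b b' u u' v v' endsA endsB sameA sameB freeA freeB disj add_arrows =>
    exact .of_bigon endsA endsB sameA sameB freeA freeB disj add_arrows i
  | type3a a a' b b' c c' sameA sameB sameC freeA freeB freeC disjAB disjBC disjCA old replace =>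
    have mem : {a, a', b, b', c, c'} ⊆ β.endpoints := by
      have ha := old (.inl rfl)
      have hb := old (.inr (.inl rfl))
      have hc := old (.inr (.inr rfl))
      rintro z (rfl | rfl | rfl | rfl | rfl | rfl)
      exacts [head_mem_endpoints hc, tail_mem_endpoints ha, head_mem_endpoints ha,
        tail_mem_endpoints hb, head_mem_endpoints hb, tail_mem_endpoints hc]
    obtain ⟨τ, H⟩ :=
      exists_triangleSwap sameA sameB sameC freeA freeB freeC disjAB disjBC disjCA mem
    exact H.sameInvariants_cyclic old replace i
  | type3b a a' b b' c c' sameA sameB sameC freeA freeB freeC disjAB disjBC disjCA old replace =>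
    have mem : {a, a', b, b', c, c'} ⊆ β.endpoints := by
      have hg := old (.inl rfl)
      have hh := old (.inr (.inl rfl))
      have hk := old (.inr (.inr rfl))
      rintro z (rfl | rfl | rfl | rfl | rfl | rfl)
      exacts [tail_mem_endpoints hg, tail_mem_endpoints hh, head_mem_endpoints hg,
        tail_mem_endpoints hk, head_mem_endpoints hh, head_mem_endpoints hk]
    obtain ⟨τ, H⟩ :=
      exists_triangleSwap sameA sameB sameC freeA freeB freeC disjAB disjBC disjCA mem
    exact H.sameInvariants_linear old replace i

theorem VirtuallyHomotopic.sameInvariants {β β' : VirtualString n}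
    (h : VirtuallyHomotopic β β') :
    ∃ σ : Equiv.Perm (Fin n), ∀ i, SameInvariants β i β' (σ i) := by
  induction h with
  | rel x y h =>
    rcases h with h | h
    · exact h.sameInvariants
    · exact ⟨1, h.sameInvariants⟩
  | refl x => exact ⟨1, SameInvariants.refl x⟩
  | symm x y _ ih =>
    obtain ⟨σ, hσ⟩ := ih
    exact ⟨σ⁻¹, fun i => by simpa using (hσ (σ⁻¹ i)).symm⟩
  | trans x y z _ _ ih₁ ih₂ =>
    obtain ⟨σ, hσ⟩ := ih₁
    obtain ⟨ρ, hρ⟩ := ih₂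
    exact ⟨ρ * σ, fun i => (hσ i).trans (hρ (σ i))⟩

end VirtualString

section Clusters

theorem sbtw_coe_of_lt {x y z : ℝ} (hxy : x < y) (hyz : y < z) (hzx : z < x + 1) :
    sbtw (x : UnitAddCircle) (y : UnitAddCircle) (z : UnitAddCircle) := by
  have toIcoMod_y : toIcoMod (Fact.out : (0 : ℝ) < 1) z y = y + 1 := by
    rw [toIcoMod_eq_iff]
    exact ⟨⟨by linarith, by linarith⟩, -1, by simp⟩
  have toIocMod_x : toIocMod (Fact.out : (0 : ℝ) < 1) z x = x + 1 := by
    rw [toIocMod_eq_iff]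
    exact ⟨⟨by linarith, by linarith⟩, -1, by simp⟩
  rw [sbtw_iff_not_btw]
  intro h
  have le : toIcoMod _ z y ≤ toIocMod _ z x := QuotientAddGroup.btw_coe_iff.1 h
  rw [toIcoMod_y, toIocMod_x] at le
  linarith

/-- The real number in `(0, 1)` representing `clusterPoint k i`. -/
noncomputable def clusterPosition (k : Fin 8) {N : ℕ} (i : Fin N) : ℝ :=
  ((k : ℕ) + ((i : ℕ) + 1) / (N + 1)) / 8

variable {k k' k'' : Fin 8} {N N' N'' : ℕ}

theorem clusterPosition_mem_Ioo (k : Fin 8) (i : Fin N) :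
    clusterPosition k i ∈ Set.Ioo (((k : ℕ) : ℝ) / 8) ((((k : ℕ) : ℝ) + 1) / 8) := by
  have hi : ((i : ℕ) : ℝ) < N := mod_cast i.2
  have pos : (0 : ℝ) < (((i : ℕ) : ℝ) + 1) / (N + 1) := by positivity
  have lt_one : (((i : ℕ) : ℝ) + 1) / (N + 1) < 1 := by
    rw [div_lt_one (by positivity)]
    linarith
  rw [clusterPosition, Set.mem_Ioo]
  constructor <;> linarith

theorem clusterPosition_lt_of_lt (h : k < k') (i : Fin N) (i' : Fin N') :
    clusterPosition k i < clusterPosition k' i' := by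
  have upper := (clusterPosition_mem_Ioo k i).2
  have lower := (clusterPosition_mem_Ioo k' i').1
  have le : ((k : ℕ) : ℝ) + 1 ≤ ((k' : ℕ) : ℝ) := mod_cast h
  linarith

theorem clusterPosition_strictMono (k : Fin 8) :
    StrictMono (clusterPosition k : Fin N → ℝ) := by
  intro i j h
  have lt : ((i : ℕ) : ℝ) < ((j : ℕ) : ℝ) := mod_cast h
  unfold clusterPosition
  gcongr

theorem sbtw_clusterPoint {i : Fin N} {i' : Fin N'} {i'' : Fin N''}
    (h : clusterPosition k i < clusterPosition k' i')
    (h' : clusterPosition k' i' < clusterPosition k'' i'') :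
    sbtw (clusterPoint k i) (clusterPoint k' i') (clusterPoint k'' i'') := by
  refine sbtw_coe_of_lt h h' ?_
  have upper := (clusterPosition_mem_Ioo k'' i'').2
  have lower := (clusterPosition_mem_Ioo k i).1
  have le : ((k'' : ℕ) : ℝ) + 1 ≤ 8 := mod_cast k''.2
  simp only [clusterPosition] at upper lower ⊢
  linarith [(Nat.cast_nonneg k : (0 : ℝ) ≤ ((k : ℕ) : ℝ))]

end Clusters

namespace VirtualString

section ParallelArrows

variable {n N M : ℕ} {c : Fin n} {k k' κ : Fin 8}

/-- The `i`-th of `N` parallel arrows on the circle `c`, from the cluster `k` to the cluster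
`k'`. -/
noncomputable def parallelArrow (c : Fin n) (k k' : Fin 8) {N : ℕ} (i : Fin N) :
    CorePoint n × CorePoint n :=
  ((c, clusterPoint k i), (c, clusterPoint k' i.rev))

@[simp] theorem parallelArrow_fst (i : Fin N) :
    (parallelArrow c k k' i).1 = (c, clusterPoint k i) := rfl

@[simp] theorem parallelArrow_snd (i : Fin N) :
    (parallelArrow c k k' i).2 = (c, clusterPoint k' i.rev) := rfl

/-- The weight of an end of the `l`-th of several parallel arrows in the loop based at the `i`-th
one. -/
def parallelWeight (i l : Fin N) : ℤ := if l = i then 1 else if i < l then 2 else 0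

theorem loopClass_parallelArrow_of_gt (hk : k' < k) (i : Fin N) {j : Fin M}
    (h : clusterPosition k i < clusterPosition κ j) :
    loopClass (parallelArrow c k k' i) (c, clusterPoint κ j) = 2 :=
  arcWeight_of_mem
    ⟨rfl, (sbtw_clusterPoint (clusterPosition_lt_of_lt hk i.rev i) h).cyclic_left⟩

theorem loopClass_parallelArrow_of_lt (hk : k' < k) (i : Fin N) {j : Fin M}
    (h : clusterPosition κ j < clusterPosition k' i.rev) :
    loopClass (parallelArrow c k k' i) (c, clusterPoint κ j) = 2 :=
  arcWeight_of_mem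
    ⟨rfl, (sbtw_clusterPoint h (clusterPosition_lt_of_lt hk i.rev i)).cyclic_right⟩

theorem loopClass_parallelArrow_of_between {i : Fin N} {j : Fin M}
    (h : clusterPosition k' i.rev < clusterPosition κ j)
    (h' : clusterPosition κ j < clusterPosition k i) :
    loopClass (parallelArrow c k k' i) (c, clusterPoint κ j) = 0 :=
  arcWeight_of_mem_swap ⟨rfl, sbtw_clusterPoint h h'⟩

theorem loopClass_parallelArrow_clusterPoint (hk : k' < k) (hκ : κ ≠ k) (hκ' : κ ≠ k')
    (i : Fin N) (j : Fin M) :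
    loopClass (parallelArrow c k k' i) (c, clusterPoint κ j) =
      if k' < κ ∧ κ < k then 0 else 2 := by
  split_ifs with h
  · exact loopClass_parallelArrow_of_between (clusterPosition_lt_of_lt h.1 _ _)
      (clusterPosition_lt_of_lt h.2 _ _)
  · rcases lt_or_gt_of_ne hκ with lt | gt
    · exact loopClass_parallelArrow_of_lt hk i (clusterPosition_lt_of_lt (by omega) _ _)
    · exact loopClass_parallelArrow_of_gt hk i (clusterPosition_lt_of_lt gt _ _)

theorem loopClass_parallelArrow_tail (hk : k' < k) (i l : Fin N) :
    loopClass (parallelArrow c k k' i) (c, clusterPoint k l) = parallelWeight i l := by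
  rcases lt_trichotomy l i with h | rfl | h
  · rw [loopClass_parallelArrow_of_between (clusterPosition_lt_of_lt hk _ _)
      (clusterPosition_strictMono k h), parallelWeight, if_neg h.ne, if_neg h.not_gt]
  · rw [parallelWeight, if_pos rfl]
    exact arcWeight_left _ _
  · rw [loopClass_parallelArrow_of_gt hk i (clusterPosition_strictMono k h), parallelWeight,
      if_neg h.ne', if_pos h]

theorem loopClass_parallelArrow_head (hk : k' < k) (i l : Fin N) :
    loopClass (parallelArrow c k k' i) (c, clusterPoint k' l.rev) = parallelWeight i l := by
  rcases lt_trichotomy l i with h | rfl | h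
  · rw [loopClass_parallelArrow_of_between (clusterPosition_strictMono k' (Fin.rev_lt_rev.2 h))
      (clusterPosition_lt_of_lt hk _ _), parallelWeight, if_neg h.ne, if_neg h.not_gt]
  · rw [parallelWeight, if_pos rfl]
    exact arcWeight_right _ _
  · rw [loopClass_parallelArrow_of_lt hk i (clusterPosition_strictMono k' (Fin.rev_lt_rev.2 h)),
      parallelWeight, if_neg h.ne', if_pos h]

theorem loopClass_parallelArrow_of_ne {z : CorePoint n} (h : z.1 ≠ c) (i : Fin N) :
    loopClass (parallelArrow c k k' i) z = 0 :=
  arcWeight_of_fst_ne rfl h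

theorem sum_parallelWeight_last {i : Fin N} (hi : (i : ℕ) + 1 = N) :
    ∑ l, parallelWeight i l = 1 := by
  have eq (l) : parallelWeight i l = if l = i then 1 else 0 := by
    rw [parallelWeight, if_neg (show ¬i < l by omega)]
  simp [eq]

end ParallelArrows

section Crossing

variable {n : ℕ} {β : VirtualString n} {c : Fin n} {p q : ℕ} {u v : ℤ}

theorem pairing_eq_sum_selfArrows {φ ψ : CorePoint n → ℤ} (hφ : ∀ z, z.1 ≠ c → φ z = 0)
    (hψ : ∀ z, z.1 ≠ c → ψ z = 0) :
    pairing β φ ψ = ∑ g ∈ selfArrows β c, (φ g.1 * ψ g.2 - φ g.2 * ψ g.1) := by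
  rw [pairing_apply, selfArrows, Finset.sum_filter_of_ne]
  intro g _ hne
  by_contra! h
  refine hne ?_
  by_cases tail : g.1.1 = c
  · rw [hφ _ (h tail), hψ _ (h tail), mul_zero, zero_mul, sub_zero]
  · rw [hφ _ tail, hψ _ tail, mul_zero, zero_mul, sub_zero]

/-- The `i`-th of several parallel arrows from left to right on the circle `c`. -/
noncomputable abbrev horizontalArrow (c : Fin n) {N : ℕ} (i : Fin N) :
    CorePoint n × CorePoint n :=
  parallelArrow c 4 0 i

/-- The `i`-th of several parallel arrows from bottom to top on the circle `c`. -/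
noncomputable abbrev verticalArrow (c : Fin n) {N : ℕ} (i : Fin N) :
    CorePoint n × CorePoint n :=
  parallelArrow c 6 2 i

/-- The self-arrows of the circle `c` are `p` parallel arrows from left to right and `q` parallel
arrows from bottom to top. The arrows between `c` and other circles end in the clusters `1` and `5`
of `c`; in these clusters, the numbers of tails minus those of heads are `u` and `v`. -/
structure IsCrossing (β : VirtualString n) (c : Fin n) (p q : ℕ) (u v : ℤ) : Prop where
  selfArrows_eq : (selfArrows β c : Set (CorePoint n × CorePoint n)) =
    Set.range (horizontalArrow c : Fin p → _) ∪ Set.range (verticalArrow c : Fin q → _)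
  pairing_one (φ : CorePoint n → ℤ) (x y : ℤ) (off : ∀ z, z.1 ≠ c → φ z = 0)
    (cluster_one : ∀ {N : ℕ} (j : Fin N), φ (c, clusterPoint 1 j) = x)
    (cluster_five : ∀ {N : ℕ} (j : Fin N), φ (c, clusterPoint 5 j) = y) :
    pairing β φ 1 = ∑ g ∈ selfArrows β c, (φ g.1 - φ g.2) + (x * u + y * v)

namespace IsCrossing

theorem horizontalArrow_mem (h : IsCrossing β c p q u v) (i : Fin p) :
    horizontalArrow c i ∈ selfArrows β c := by
  rw [← Finset.mem_coe, h.selfArrows_eq]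
  exact .inl ⟨i, rfl⟩

theorem verticalArrow_mem (h : IsCrossing β c p q u v) (j : Fin q) :
    verticalArrow c j ∈ selfArrows β c := by
  rw [← Finset.mem_coe, h.selfArrows_eq]
  exact .inr ⟨j, rfl⟩

theorem sum_selfArrows (h : IsCrossing β c p q u v) (f : CorePoint n × CorePoint n → ℤ) :
    ∑ g ∈ selfArrows β c, f g =
      ∑ i : Fin p, f (horizontalArrow c i) + ∑ j : Fin q, f (verticalArrow c j) := by
  classical
  have arrows_eq : selfArrows β c =
      Finset.univ.image (Sum.elim (horizontalArrow c : Fin p → _) (verticalArrow c : Fin q → _)) :=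
    Finset.coe_injective (by simp [h.selfArrows_eq, Set.Sum.elim_range])
  have injective : Function.Injective
      (Sum.elim (horizontalArrow c : Fin p → _) (verticalArrow c : Fin q → _)) := by
    rintro (i | i) (j | j) e
    · simpa [parallelArrow, clusterPoint_inj] using e
    · simp [parallelArrow, clusterPoint_ne] at e
    · simp [parallelArrow, clusterPoint_ne] at e
    · simpa [parallelArrow, clusterPoint_inj] using e
  rw [arrows_eq, Finset.sum_image injective.injOn, Fintype.sum_sum_type]
  rfl

theorem circleIndex_eq (h : IsCrossing β c p q u v) : circleIndex β c = u + v := by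
  rw [circleIndex, h.pairing_one _ 1 1 (fun z => circleIndicator_of_ne) (fun _ => if_pos rfl)
    (fun _ => if_pos rfl), Finset.sum_eq_zero]
  · ring
  · intro g hg
    obtain ⟨-, tail, head⟩ := mem_selfArrows.1 hg
    simp [circleIndicator, tail, head]

theorem pairing_circleIndicator {φ : CorePoint n → ℤ} (off : ∀ z, z.1 ≠ c → φ z = 0) :
    pairing β φ (circleIndicator c) = ∑ g ∈ selfArrows β c, (φ g.1 - φ g.2) := by
  rw [pairing_eq_sum_selfArrows off fun z => circleIndicator_of_ne]
  refine Finset.sum_congr rfl fun g hg => ?_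
  obtain ⟨-, tail, head⟩ := mem_selfArrows.1 hg
  simp [circleIndicator, tail, head]

theorem sum_horizontal (h : IsCrossing β c p q u v) (i : Fin p) :
    ∑ g ∈ selfArrows β c,
      (loopClass (horizontalArrow c i) g.1 - loopClass (horizontalArrow c i) g.2) = 2 * q := by
  rw [h.sum_selfArrows]
  simp [loopClass_parallelArrow_tail, loopClass_parallelArrow_head,
    loopClass_parallelArrow_clusterPoint, mul_comm]

theorem sum_vertical (h : IsCrossing β c p q u v) (j : Fin q) :
    ∑ g ∈ selfArrows β c,
      (loopClass (verticalArrow c j) g.1 - loopClass (verticalArrow c j) g.2) = -(2 * p) := by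
  rw [h.sum_selfArrows]
  simp [loopClass_parallelArrow_tail, loopClass_parallelArrow_head,
    loopClass_parallelArrow_clusterPoint, mul_comm]

theorem loopLabel_horizontal (h : IsCrossing β c p q u v) (i : Fin p) :
    loopLabel β c (loopClass (horizontalArrow c i)) = (2 * (q : ℤ), 2 * q + 2 * v) := by
  have off (z : CorePoint n) (hz : z.1 ≠ c) : loopClass (horizontalArrow c i) z = 0 :=
    loopClass_parallelArrow_of_ne hz i
  have one := h.pairing_one _ 0 2 off
    (fun j => loopClass_parallelArrow_clusterPoint (by decide) (by decide) (by decide) i j)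
    (fun j => loopClass_parallelArrow_clusterPoint (by decide) (by decide) (by decide) i j)
  rw [loopLabel, pairing_circleIndicator off, one, h.sum_horizontal, zero_mul, zero_add]

theorem loopLabel_vertical (h : IsCrossing β c p q u v) (j : Fin q) :
    loopLabel β c (loopClass (verticalArrow c j)) = (-(2 * (p : ℤ)), -(2 * p) + 2 * u) := by
  have off (z : CorePoint n) (hz : z.1 ≠ c) : loopClass (verticalArrow c j) z = 0 :=
    loopClass_parallelArrow_of_ne hz j
  have one := h.pairing_one _ 2 0 off
    (fun j' => loopClass_parallelArrow_clusterPoint (by decide) (by decide) (by decide) j j')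
    (fun j' => loopClass_parallelArrow_clusterPoint (by decide) (by decide) (by decide) j j')
  rw [loopLabel, pairing_circleIndicator off, one, h.sum_vertical, zero_mul, add_zero]

theorem loopLabel_horizontal_swap (h : IsCrossing β c p q u v) (i : Fin p) :
    loopLabel β c (loopClass (horizontalArrow c i).swap) = (-(2 * (q : ℤ)), 2 * u - 2 * q) := by
  rw [loopLabel_swap (h.horizontalArrow_mem i), h.loopLabel_horizontal, h.circleIndex_eq,
    Prod.mk_sub_mk, zero_sub]
  congr 1
  ring

theorem loopLabel_vertical_swap (h : IsCrossing β c p q u v) (j : Fin q) :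
    loopLabel β c (loopClass (verticalArrow c j).swap) = (2 * (p : ℤ), 2 * p + 2 * v) := by
  rw [loopLabel_swap (h.verticalArrow_mem j), h.loopLabel_vertical, h.circleIndex_eq,
    Prod.mk_sub_mk, zero_sub, neg_neg]
  congr 1
  ring

theorem pairing_horizontal_horizontal (h : IsCrossing β c p q u v) (i i' : Fin p) :
    pairing β (loopClass (horizontalArrow c i)) (loopClass (horizontalArrow c i')) = 0 := by
  rw [pairing_eq_sum_selfArrows (fun z hz => loopClass_parallelArrow_of_ne hz i)
    (fun z hz => loopClass_parallelArrow_of_ne hz i'), h.sum_selfArrows]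
  simp [loopClass_parallelArrow_tail, loopClass_parallelArrow_head,
    loopClass_parallelArrow_clusterPoint]

theorem pairing_vertical_vertical (h : IsCrossing β c p q u v) (j j' : Fin q) :
    pairing β (loopClass (verticalArrow c j)) (loopClass (verticalArrow c j')) = 0 := by
  rw [pairing_eq_sum_selfArrows (fun z hz => loopClass_parallelArrow_of_ne hz j)
    (fun z hz => loopClass_parallelArrow_of_ne hz j'), h.sum_selfArrows]
  simp [loopClass_parallelArrow_tail, loopClass_parallelArrow_head,
    loopClass_parallelArrow_clusterPoint]

theorem pairing_vertical_swap_vertical_swap (h : IsCrossing β c p q u v) (j j' : Fin q) :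
    pairing β (loopClass (verticalArrow c j).swap) (loopClass (verticalArrow c j').swap) = 0 := by
  have label (j : Fin q) : pairing β (loopClass (verticalArrow c j)) (circleIndicator c) =
      -(2 * p) := congrArg Prod.fst (h.loopLabel_vertical j)
  rw [loopClass_swap (h.verticalArrow_mem j), loopClass_swap (h.verticalArrow_mem j')]
  simp only [map_sub, map_smul, LinearMap.sub_apply, LinearMap.smul_apply, pairing_self,
    h.pairing_vertical_vertical, ← neg_pairing β (loopClass (verticalArrow c j')), label]
  ring

theorem pairing_horizontal_vertical_last (h : IsCrossing β c p q u v) {i : Fin p} {j : Fin q}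
    (hi : (i : ℕ) + 1 = p) (hj : (j : ℕ) + 1 = q) :
    pairing β (loopClass (horizontalArrow c i)) (loopClass (verticalArrow c j)) = 4 := by
  rw [pairing_eq_sum_selfArrows (fun z hz => loopClass_parallelArrow_of_ne hz i)
    (fun z hz => loopClass_parallelArrow_of_ne hz j), h.sum_selfArrows]
  simp [loopClass_parallelArrow_tail, loopClass_parallelArrow_head,
    loopClass_parallelArrow_clusterPoint, ← Finset.sum_mul, ← Finset.mul_sum,
    sum_parallelWeight_last hi, sum_parallelWeight_last hj]

theorem pairing_horizontal_vertical_swap_last (h : IsCrossing β c p q u v) {i : Fin p}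
    {j : Fin q} (hi : (i : ℕ) + 1 = p) (hj : (j : ℕ) + 1 = q) :
    pairing β (loopClass (horizontalArrow c i)) (loopClass (verticalArrow c j).swap) =
      4 * q - 4 := by
  have label : pairing β (loopClass (horizontalArrow c i)) (circleIndicator c) = 2 * q :=
    congrArg Prod.fst (h.loopLabel_horizontal i)
  rw [loopClass_swap (h.verticalArrow_mem j), map_sub, map_smul, label,
    h.pairing_horizontal_vertical_last hi hj, smul_eq_mul]
  ring

theorem loopSum_eq (h : IsCrossing β c p q u v) {f : (CorePoint n → ℤ) → ℤ}
    (hf : ∀ φ, (loopLabel β c φ).1 ≤ 0 → f φ = 0) :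
    loopSum β c f = ∑ i : Fin p, f (loopClass (horizontalArrow c i)) -
      ∑ j : Fin q, f (loopClass (verticalArrow c j).swap) := by
  have horizontal (i : Fin p) : f (loopClass (horizontalArrow c i).swap) = 0 :=
    hf _ (by rw [h.loopLabel_horizontal_swap]; exact neg_nonpos.2 (by positivity))
  have vertical (j : Fin q) : f (loopClass (verticalArrow c j)) = 0 :=
    hf _ (by rw [h.loopLabel_vertical]; exact neg_nonpos.2 (by positivity))
  rw [loopSum, h.sum_selfArrows]
  simp only [horizontal, vertical, sub_zero, zero_sub, Finset.sum_neg_distrib, ← sub_eq_add_neg]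

theorem linearInvariant_eq (h : IsCrossing β c p q u v) {κ : ℤ × ℤ} (hκ : 0 < κ.1) :
    linearInvariant β c κ = p * (if (2 * (q : ℤ), 2 * q + 2 * v) = κ then 1 else 0) -
      q * (if (2 * (p : ℤ), 2 * p + 2 * v) = κ then 1 else 0) := by
  rw [linearInvariant, h.loopSum_eq fun φ hφ => if_neg fun e => (e ▸ hφ).not_gt hκ]
  simp only [h.loopLabel_horizontal, h.loopLabel_vertical_swap, Finset.sum_const,
    Finset.card_univ, Fintype.card_fin, nsmul_eq_mul]

theorem quadraticInvariant_eq (h : IsCrossing β c p q u v) {κ : ℤ × ℤ} (hκ : 0 < κ.1) :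
    quadraticInvariant β c κ =
      -2 * if (2 * (q : ℤ), 2 * q + 2 * v) = κ ∧ (2 * (p : ℤ), 2 * p + 2 * v) = κ then
        ∑ i : Fin p, ∑ j : Fin q,
          pairing β (loopClass (horizontalArrow c i)) (loopClass (verticalArrow c j).swap) ^ 2
      else 0 := by
  have vanish (φ ψ) (hφ : (loopLabel β c φ).1 ≤ 0) : labelledSquare β c κ φ ψ = 0 :=
    if_neg fun e => (e.1 ▸ hφ).not_gt hκ
  have vanish' (φ ψ) (hψ : (loopLabel β c ψ).1 ≤ 0) : labelledSquare β c κ φ ψ = 0 := by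
    rw [labelledSquare_comm, vanish _ _ hψ]
  have loopSum_loopSum := h.loopSum_eq (f := fun φ => loopSum β c (labelledSquare β c κ φ))
    fun φ hφ => Finset.sum_eq_zero fun g _ => by rw [vanish _ _ hφ, vanish _ _ hφ, sub_zero]
  have mixed (i : Fin p) (j : Fin q) :
      labelledSquare β c κ (loopClass (verticalArrow c j).swap)
        (loopClass (horizontalArrow c i)) =
      labelledSquare β c κ (loopClass (horizontalArrow c i))
        (loopClass (verticalArrow c j).swap) := labelledSquare_comm κ
  rw [quadraticInvariant, loopSum_loopSum]
  simp only [h.loopSum_eq (vanish' _), mixed]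
  simp only [labelledSquare, h.pairing_horizontal_horizontal,
    h.pairing_vertical_swap_vertical_swap, h.loopLabel_horizontal, h.loopLabel_vertical_swap,
    ne_eq, OfNat.ofNat_ne_zero, not_false_eq_true, zero_pow, ite_self, Finset.sum_const_zero,
    zero_sub, sub_zero, Finset.sum_neg_distrib]
  rw [Finset.sum_comm (s := (Finset.univ : Finset (Fin q)))]
  split_ifs
  · ring
  · simp

theorem sum_sq_pos (h : IsCrossing β c p q u v) (hp : 0 < p) (hq : 2 ≤ q) :
    0 < ∑ i : Fin p, ∑ j : Fin q,
      pairing β (loopClass (horizontalArrow c i)) (loopClass (verticalArrow c j).swap) ^ 2 := by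
  refine Finset.sum_pos' (fun i _ => Finset.sum_nonneg fun j _ => sq_nonneg _)
    ⟨⟨p - 1, by omega⟩, Finset.mem_univ _, ?_⟩
  refine Finset.sum_pos' (fun j _ => sq_nonneg _) ⟨⟨q - 1, by omega⟩, Finset.mem_univ _, ?_⟩
  rw [h.pairing_horizontal_vertical_swap_last (Nat.sub_add_cancel hp)
    (Nat.sub_add_cancel (by omega : 1 ≤ q))]
  have ne_zero : (4 * q - 4 : ℤ) ≠ 0 := by omega
  positivity

variable {β' : VirtualString n} {c' : Fin n} {p' q' : ℕ} {u' v' : ℤ}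

theorem eq_of_ne (h : IsCrossing β c p q u v) (h' : IsCrossing β' c' p' q' u' v')
    (same : SameInvariants β c β' c') (hp : 0 < p) (hq : 0 < q) (hpq : p ≠ q) :
    p = p' ∧ q = q' ∧ v = v' := by
  have pos : (0 : ℤ) < 2 * q := by omega
  have linear := same.linearInvariant_eq (2 * q, 2 * q + 2 * v) pos.ne'
  rw [h.linearInvariant_eq pos, h'.linearInvariant_eq pos] at linear
  simp only [Prod.mk.injEq] at linear
  split_ifs at linear <;> omega

theorem eq_of_eq (h : IsCrossing β c p p u v) (h' : IsCrossing β' c' p' q' u' v')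
    (same : SameInvariants β c β' c') (hp : 2 ≤ p) (hp' : 0 < p') (hq' : 0 < q') :
    p = p' ∧ p = q' ∧ v = v' := by
  have p'_eq_q' : p' = q' := by
    by_contra ne
    obtain ⟨eq, eq', -⟩ := h'.eq_of_ne h same.symm hp' hq' ne
    exact ne (eq.trans eq'.symm)
  subst p'_eq_q'
  have pos : (0 : ℤ) < 2 * p := by omega
  have quadratic := same.quadraticInvariant_eq (2 * p, 2 * p + 2 * v) pos.ne'
  rw [h.quadraticInvariant_eq pos, h'.quadraticInvariant_eq pos, if_pos ⟨rfl, rfl⟩] at quadratic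
  have sum_pos := h.sum_sq_pos (by omega) hp
  simp only [Prod.mk.injEq] at quadratic
  split_ifs at quadratic <;> omega

theorem parameters_eq (h : IsCrossing β c p q u v) (h' : IsCrossing β' c' p' q' u' v')
    (same : SameInvariants β c β' c') (hp : 0 < p) (hq : 0 < q) (hpq : ¬(p = 1 ∧ q = 1))
    (hp' : 0 < p') (hq' : 0 < q') : p = p' ∧ q = q' ∧ u = u' ∧ v = v' := by
  have index : u + v = u' + v' := by
    rw [← h.circleIndex_eq, ← h'.circleIndex_eq, same.circleIndex_eq]
  obtain ⟨p_eq, q_eq, v_eq⟩ : p = p' ∧ q = q' ∧ v = v' := by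
    rcases eq_or_ne p q with rfl | ne
    · exact h.eq_of_eq h' same (by omega) hp' hq'
    · exact h.eq_of_ne h' same hp hq ne
  exact ⟨p_eq, q_eq, by omega, v_eq⟩

end IsCrossing

end Crossing

section BetaString

variable (p₁ q₁ p₂ q₂ r s : ℕ)

theorem sum_arrows_betaString (f : CorePoint 2 × CorePoint 2 → ℤ) :
    ∑ g ∈ (betaString p₁ q₁ p₂ q₂ r s).finite_arrows.toFinset, f g =
      ∑ x : BetaIndex p₁ q₁ p₂ q₂ r s, f (betaTail x, betaHead x) := by
  classical
  have arrows_eq : (betaString p₁ q₁ p₂ q₂ r s).finite_arrows.toFinset =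
      Finset.univ.image fun x : BetaIndex p₁ q₁ p₂ q₂ r s => (betaTail x, betaHead x) := by
    ext g
    simp [betaString]
  rw [arrows_eq, Finset.sum_image]
  intro x _ y _ h
  exact betaTail_injective (Prod.ext_iff.1 h).1

theorem isCrossing_betaString_zero :
    IsCrossing (betaString p₁ q₁ p₂ q₂ r s) 0 p₁ q₁ r (-s) where
  selfArrows_eq := by
    refine Set.Subset.antisymm (fun g hg => ?_) ?_
    · obtain ⟨⟨(i | i) | (i | i) | (i | i), rfl⟩, tail, head⟩ := mem_selfArrows.1 hg
      exacts [.inl ⟨i, rfl⟩, .inr ⟨i, rfl⟩, absurd tail one_ne_zero, absurd tail one_ne_zero,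
        absurd head one_ne_zero, absurd tail one_ne_zero]
    · rintro _ (⟨i, rfl⟩ | ⟨i, rfl⟩)
      exacts [mem_selfArrows.2 ⟨⟨.inl (.inl i), rfl⟩, rfl, rfl⟩,
        mem_selfArrows.2 ⟨⟨.inl (.inr i), rfl⟩, rfl, rfl⟩]
  pairing_one φ x y off cluster_one cluster_five := by
    have off_one (z : UnitAddCircle) : φ (1, z) = 0 := off _ (by simp)
    rw [pairing_apply, selfArrows, Finset.sum_filter, sum_arrows_betaString, sum_arrows_betaString]
    simp [betaTail, betaHead, off_one, cluster_one, cluster_five]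
    ring

theorem isCrossing_betaString_one :
    IsCrossing (betaString p₁ q₁ p₂ q₂ r s) 1 p₂ q₂ (-r) s where
  selfArrows_eq := by
    refine Set.Subset.antisymm (fun g hg => ?_) ?_
    · obtain ⟨⟨(i | i) | (i | i) | (i | i), rfl⟩, tail, head⟩ := mem_selfArrows.1 hg
      exacts [absurd tail zero_ne_one, absurd tail zero_ne_one, .inl ⟨i, rfl⟩, .inr ⟨i, rfl⟩,
        absurd tail zero_ne_one, absurd head zero_ne_one]
    · rintro _ (⟨i, rfl⟩ | ⟨i, rfl⟩)
      exacts [mem_selfArrows.2 ⟨⟨.inr (.inl (.inl i)), rfl⟩, rfl, rfl⟩,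
        mem_selfArrows.2 ⟨⟨.inr (.inl (.inr i)), rfl⟩, rfl, rfl⟩]
  pairing_one φ x y off cluster_one cluster_five := by
    have off_zero (z : UnitAddCircle) : φ (0, z) = 0 := off _ (by simp)
    rw [pairing_apply, selfArrows, Finset.sum_filter, sum_arrows_betaString, sum_arrows_betaString]
    simp [betaTail, betaHead, off_zero, cluster_one, cluster_five]
    ring

end BetaString

section Trivial

variable {n N : ℕ} {β β' : VirtualString n} {c : Fin n} {k k' : Fin 8}

theorem ext_arrows (h : β.arrows = β'.arrows) : β = β' := by
  cases β
  cases β'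
  cases h
  rfl

/-- The virtual string obtained from `β` by deleting the arrow `g`. -/
def erase (β : VirtualString n) (g : CorePoint n × CorePoint n) : VirtualString n where
  arrows := β.arrows \ {g}
  finite_arrows := β.finite_arrows.sdiff
  tail_ne_head := fun g hg h hh => β.tail_ne_head g hg.1 h hh.1
  tail_injOn := β.tail_injOn.mono Set.sdiff_subset
  head_injOn := β.head_injOn.mono Set.sdiff_subset

theorem erase_arrows (g : CorePoint n × CorePoint n) : (β.erase g).arrows = β.arrows \ {g} := rfl

theorem virtuallyHomotopic_erase {g : CorePoint n × CorePoint n} (hg : g ∈ β.arrows)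
    (same : g.1.1 = g.2.1) (free : Disjoint (arc g.1 g.2) (β.erase g).endpoints) :
    VirtuallyHomotopic β (β.erase g) :=
  .symm _ _ (.rel _ _ (.inr (.type1a _ _ g.1 g.2 same free (Set.insert_sdiff_self_of_mem hg).symm)))

theorem notMem_arc_parallelArrow {i l : Fin N} (hk : k' < k) (hl : l < i) :
    (parallelArrow c k k' l).1 ∉ arc (parallelArrow c k k' i).1 (parallelArrow c k k' i).2 ∧
      (parallelArrow c k k' l).2 ∉ arc (parallelArrow c k k' i).1 (parallelArrow c k k' i).2 := by
  have ends_ne : (parallelArrow c k k' i).1 ≠ (parallelArrow c k k' i).2 :=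
    fun e => clusterPoint_ne hk.ne' _ _ (congrArg Prod.snd e)
  have weight : parallelWeight i l = 0 := by simp [parallelWeight, hl.ne, hl.not_gt]
  exact ⟨notMem_arc_of_arcWeight_eq_zero rfl ends_ne
      ((loopClass_parallelArrow_tail hk i l).trans weight),
    notMem_arc_of_arcWeight_eq_zero rfl ends_ne
      ((loopClass_parallelArrow_head hk i l).trans weight)⟩

theorem virtuallyHomotopic_trivial_of_image_lt (hk : k' < k) {m : ℕ} (hm : m ≤ N)
    (h : β.arrows = parallelArrow c k k' '' {i : Fin N | (i : ℕ) < m}) :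
    VirtuallyHomotopic β (trivial n) := by
  induction m generalizing β with
  | zero =>
    have eq_trivial : β = trivial n := ext_arrows (by simp [h, trivial])
    exact eq_trivial ▸ .refl _
  | succ m ih =>
    let last : Fin N := ⟨m, hm⟩
    have arrows_eq : (β.erase (parallelArrow c k k' last)).arrows =
        parallelArrow c k k' '' {i : Fin N | (i : ℕ) < m} := by
      have injective : Function.Injective (parallelArrow c k k' : Fin N → _) :=
        fun i j e => (clusterPoint_inj.1 (congrArg (fun g => g.1.2) e)).2
      rw [erase_arrows, h, ← Set.image_singleton, ← Set.image_sdiff injective]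
      congr 1
      ext i
      simp only [Set.mem_sdiff, Set.mem_ofPred_eq, Set.mem_singleton_iff, last, Fin.ext_iff]
      omega
    refine .trans _ _ _ (virtuallyHomotopic_erase (g := parallelArrow c k k' last) ?_ rfl ?_)
      (ih (by omega) arrows_eq)
    · rw [h]
      exact ⟨last, m.lt_succ_self, rfl⟩
    · rw [Set.disjoint_right, endpoints, arrows_eq]
      rintro _ (⟨_, ⟨l, hl, rfl⟩, rfl⟩ | ⟨_, ⟨l, hl, rfl⟩, rfl⟩)
      exacts [(notMem_arc_parallelArrow hk hl).1, (notMem_arc_parallelArrow hk hl).2]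

theorem virtuallyHomotopic_trivial_of_parallel (hk : k' < k)
    (h : β.arrows = Set.range (parallelArrow c k k' : Fin N → _)) :
    VirtuallyHomotopic β (trivial n) :=
  virtuallyHomotopic_trivial_of_image_lt (c := c) (N := N) hk le_rfl (by simp [h])

theorem virtuallyHomotopic_trivial_of_simple_crossing
    (h : β.arrows = Set.range (horizontalArrow c : Fin 1 → _) ∪
      Set.range (verticalArrow c : Fin 1 → _)) :
    VirtuallyHomotopic β (trivial n) := by
  let point (k : Fin 8) : CorePoint n := (c, clusterPoint k (0 : Fin 1))
  have order {k k' k'' : Fin 8} (hk : k < k') (hk' : k' < k'') :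
      sbtw (point k).2 (point k').2 (point k'').2 :=
    sbtw_clusterPoint (clusterPosition_lt_of_lt hk _ _) (clusterPosition_lt_of_lt hk' _ _)
  have disjoint : Disjoint (arc (point 2) (point 4)) (arc (point 6) (point 0)) := by
    rw [Set.disjoint_left]
    exact fun z hz hz' => not_btw_of_sbtw_of_btw (order (by decide) (by decide))
      (order (by decide) (by decide)).cyclic_left hz.2 hz'.2
  refine .symm _ _ (.rel _ _ (.inr (.type2 _ _ (point 4) (point 2) (point 0) (point 6) (point 2)
    (point 4) (point 6) (point 0) (.inr rfl) (.inr rfl) rfl rfl ?_ ?_ disjoint ?_)))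
  · simp [endpoints, trivial]
  · simp [endpoints, trivial]
  · ext g
    simp [h, parallelArrow, trivial, point, eq_comm]

end Trivial

theorem IsNontrivial.parameters {β : VirtualString 1} {p q : ℕ} (hβ : β.IsNontrivial)
    (h : β.arrows = Set.range (horizontalArrow 0 : Fin p → _) ∪
      Set.range (verticalArrow 0 : Fin q → _)) :
    0 < p ∧ 0 < q ∧ ¬(p = 1 ∧ q = 1) := by
  refine ⟨Nat.pos_of_ne_zero ?_, Nat.pos_of_ne_zero ?_, ?_⟩
  · rintro rfl
    rw [Set.range_eq_empty, Set.empty_union] at h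
    exact hβ (virtuallyHomotopic_trivial_of_parallel (by decide) h)
  · rintro rfl
    rw [Set.range_eq_empty (verticalArrow 0 : Fin 0 → _), Set.union_empty] at h
    exact hβ (virtuallyHomotopic_trivial_of_parallel (by decide) h)
  · rintro ⟨rfl, rfl⟩
    exact hβ (virtuallyHomotopic_trivial_of_simple_crossing h)

section BetaString

variable (p₁ q₁ p₂ q₂ r s : ℕ)

theorem component_zero_arrows : ((betaString p₁ q₁ p₂ q₂ r s).component 0).arrows =
    Set.range (horizontalArrow 0 : Fin p₁ → _) ∪ Set.range (verticalArrow 0 : Fin q₁ → _) := by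
  ext ⟨⟨i, x⟩, ⟨j, y⟩⟩
  obtain rfl := Subsingleton.elim i 0
  obtain rfl := Subsingleton.elim j 0
  simp [component, betaString, onCircle, parallelArrow, betaTail, betaHead]

theorem component_one_arrows : ((betaString p₁ q₁ p₂ q₂ r s).component 1).arrows =
    Set.range (horizontalArrow 0 : Fin p₂ → _) ∪ Set.range (verticalArrow 0 : Fin q₂ → _) := by
  ext ⟨⟨i, x⟩, ⟨j, y⟩⟩
  obtain rfl := Subsingleton.elim i 0
  obtain rfl := Subsingleton.elim j 0
  simp [component, betaString, onCircle, parallelArrow, betaTail, betaHead]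

end BetaString

theorem Same.refl {n : ℕ} (β : VirtualString n) : Same β β :=
  ⟨1, fun _ => Homeomorph.refl _, fun _ _ _ _ => Iff.rfl, by simp [Prod.map]⟩

theorem same_betaString_swap (p q p' q' : ℕ) :
    Same (betaString p q p' q' 0 0) (betaString p' q' p q 0 0) := by
  refine ⟨Equiv.swap 0 1, fun _ => Homeomorph.refl _, fun _ _ _ _ => Iff.rfl, ?_⟩
  apply Set.Subset.antisymm
  · rintro _ ⟨(i | i) | (i | i) | (i | i), rfl⟩
    exacts [⟨_, ⟨.inr (.inl (.inl i)), rfl⟩, rfl⟩, ⟨_, ⟨.inr (.inl (.inr i)), rfl⟩, rfl⟩,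
      ⟨_, ⟨.inl (.inl i), rfl⟩, rfl⟩, ⟨_, ⟨.inl (.inr i), rfl⟩, rfl⟩, i.elim0, i.elim0]
  · rintro _ ⟨_, ⟨(i | i) | (i | i) | (i | i), rfl⟩, rfl⟩
    exacts [⟨.inr (.inl (.inl i)), rfl⟩, ⟨.inr (.inl (.inr i)), rfl⟩, ⟨.inl (.inl i), rfl⟩,
      ⟨.inl (.inr i), rfl⟩, i.elim0, i.elim0]

end VirtualString

open VirtualString

theorem proposition4p3 (p₁ q₁ p₂ q₂ r s p₁' q₁' p₂' q₂' r' s' : ℕ)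
    (h₁ : ∀ i, ((betaString p₁ q₁ p₂ q₂ r s).component i).IsNontrivial)
    (h₂ : ∀ i, ((betaString p₁' q₁' p₂' q₂' r' s').component i).IsNontrivial) :
    (betaString p₁' q₁' p₂' q₂' r' s').VirtuallyHomotopic (betaString p₁ q₁ p₂ q₂ r s) ↔
      (betaString p₁' q₁' p₂' q₂' r' s').Same (betaString p₁ q₁ p₂ q₂ r s) := by
  refine ⟨fun h => ?_, fun h => .rel _ _ (.inl h)⟩
  obtain ⟨hp₁, hq₁, -⟩ := (h₁ 0).parameters (component_zero_arrows ..)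
  obtain ⟨hp₂, hq₂, -⟩ := (h₁ 1).parameters (component_one_arrows ..)
  obtain ⟨hp₁', hq₁', ne₁⟩ := (h₂ 0).parameters (component_zero_arrows ..)
  obtain ⟨hp₂', hq₂', ne₂⟩ := (h₂ 1).parameters (component_one_arrows ..)
  have zero := isCrossing_betaString_zero p₁ q₁ p₂ q₂ r s
  have one := isCrossing_betaString_one p₁ q₁ p₂ q₂ r s
  have zero' := isCrossing_betaString_zero p₁' q₁' p₂' q₂' r' s'
  have one' := isCrossing_betaString_one p₁' q₁' p₂' q₂' r' s'
  obtain ⟨σ, same⟩ := h.sameInvariants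
  have perm_cases : ∀ σ : Equiv.Perm (Fin 2), σ = 1 ∨ σ = Equiv.swap 0 1 := by decide
  obtain rfl | rfl := perm_cases σ
  · obtain ⟨rfl, rfl, hr, hs⟩ := zero'.parameters_eq zero (same 0) hp₁' hq₁' ne₁ hp₁ hq₁
    obtain ⟨rfl, rfl, -⟩ := one'.parameters_eq one (same 1) hp₂' hq₂' ne₂ hp₂ hq₂
    obtain ⟨rfl, rfl⟩ : r' = r ∧ s' = s := by omega
    exact Same.refl _
  · obtain ⟨rfl, rfl, hr, hs⟩ := zero'.parameters_eq one (same 0) hp₁' hq₁' ne₁ hp₂ hq₂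
    obtain ⟨rfl, rfl, -⟩ := one'.parameters_eq zero (same 1) hp₂' hq₂' ne₂ hp₁ hq₁
    obtain ⟨rfl, rfl, rfl, rfl⟩ : r = 0 ∧ s = 0 ∧ r' = 0 ∧ s' = 0 := by omega
    exact same_betaString_swap ..
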